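/- Let $k$ be a field and let $H$ be a Hopf algebra over $k$, not necessarily finite-dimensional. Let $H_0$ be its coradical (the sum of the simple subcoalgebras of $H$), and let $H_0\subseteq H_1\subseteq H_2\subseteq\cdots$ be its coradical filtration, given by $H_{n+1}=\Delta^{-1}(H_n\otimes H+H\otimes H_0)$; put $H_{-1}=0$. Assume that $H_0$ is a Hopf subalgebra of $H$, that is, a subalgebra and subcoalgebra stable under the antipode. Then the product, coproduct and antipode of $H$ induce the structure of a graded Hopf algebra on $\operatorname{gr}H=\bigoplus_{n\ge 0}H_n/H_{n-1}$. Let $\pi\colon\operatorname{gr}H\to H_0$ be the projection onto the component of degree zero, which is a morphism of Hopf algebras, and let the diagram of $H$ be the subalgebra of coinvariants $$R=\{a\in\operatorname{gr}H : (\operatorname{id}\otimes\pi)\Delta(a)=a\otimes 1\}.$$ Call a Hopf algebra $A$ over $k$ co-Frobenius if it has a non-zero left integral, that is, a non-zero linear map $T\colon A\to k$ such that $\alpha T=\alpha(1)\,T$ in the convolution algebra $A^*$ for every $\alpha\in A^*$. The following assertions are equivalent: 1. $H$ is co-Frobenius; 2. the associated graded Hopf algebra $\operatorname{gr}H$ is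 co-Frobenius; 3. the diagram $R$ of $H$ is finite-dimensional; 4. the coradical filtration of $H$ is finite, i.e. there exists $n\ge 0$ such that $H_n=H$. -/

import Mathlib

open scoped TensorProduct

namespace CoradFilt

universe u v

noncomputable section

section Coalgebras

variable (k : Type u) [Field k] {C : Type v} [AddCommGroup C] [Module k C]

/-- The image of `V ⊗ W` inside `C ⊗ C`, for subspaces `V`, `W` of `C`. -/
def tensorSub (V W : Submodule k C) : Submodule k (C ⊗[k] C) :=
  LinearMap.range (TensorProduct.mapIncl V W)

variable {k}

theorem tmul_mem_tensorSub {V W : Submodule k C} {v w : C} (hv : v ∈ V) (hw : w ∈ W) :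
    v ⊗ₜ[k] w ∈ tensorSub k V W :=
  ⟨(⟨v, hv⟩ : V) ⊗ₜ (⟨w, hw⟩ : W), rfl⟩

theorem tensorSub_le {V W : Submodule k C} {P : Submodule k (C ⊗[k] C)}
    (h : ∀ v ∈ V, ∀ w ∈ W, v ⊗ₜ[k] w ∈ P) : tensorSub k V W ≤ P := by
  rintro _ ⟨t, rfl⟩
  induction t with
  | zero => simp
  | tmul x y => exact h _ x.2 _ y.2
  | add x y hx hy => rw [map_add]; exact P.add_mem hx hy

theorem tensorSub_mono {V W V' W' : Submodule k C} (h : V ≤ V') (h' : W ≤ W') :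
    tensorSub k V W ≤ tensorSub k V' W' :=
  tensorSub_le fun _ hv _ hw => tmul_mem_tensorSub (h hv) (h' hw)

/-- An element of `U ⊗ C` that dies in `C/V ⊗ C/W`, where `V ≤ U`, lies in `V ⊗ C + U ⊗ W`. -/
theorem mem_sup_of_map_mkQ_eq_zero {U V W : Submodule k C} {t : C ⊗[k] C}
    (ht : t ∈ tensorSub k U ⊤) (h0 : TensorProduct.map V.mkQ W.mkQ t = 0) :
    t ∈ tensorSub k V ⊤ ⊔ tensorSub k U W := by
  obtain ⟨s, rfl⟩ := ht
  let g : U →ₗ[k] C ⧸ V := V.mkQ ∘ₗ U.subtype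
  let g' : (⊤ : Submodule k C) →ₗ[k] C ⧸ W := W.mkQ ∘ₗ (⊤ : Submodule k C).subtype
  have hg' : Function.Surjective g' := fun y => by
    obtain ⟨c, rfl⟩ := W.mkQ_surjective y
    exact ⟨⟨c, trivial⟩, rfl⟩
  have h1 : TensorProduct.map g.rangeRestrict g' s = 0 := by
    have inj : Function.Injective ((LinearMap.range g).subtype.rTensor (C ⧸ W)) :=
      Module.Flat.rTensor_preserves_injective_linearMap _ (Submodule.injective_subtype _)
    apply inj
    rw [map_zero, ← h0, ← LinearMap.comp_apply, ← LinearMap.comp_apply]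
    congr 1
    ext x y
    rfl
  have h2 : s ∈ LinearMap.ker (TensorProduct.map g.rangeRestrict g') := h1
  rw [TensorProduct.map_ker (f := (LinearMap.ker g.rangeRestrict).subtype)
    (f' := (LinearMap.ker g').subtype) (LinearMap.exact_subtype_ker_map _)
    g.surjective_rangeRestrict (LinearMap.exact_subtype_ker_map _) hg'] at h2
  obtain ⟨a, ⟨a, rfl⟩, b, ⟨b, rfl⟩, rfl⟩ := Submodule.mem_sup.1 h2
  rw [map_add, add_comm]
  refine Submodule.add_mem_sup ?_ ?_
  · clear h2 h1 h0
    induction b with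
    | zero => simp
    | tmul x y =>
      refine tmul_mem_tensorSub ?_ trivial
      have hx : g x = 0 := congrArg Subtype.val x.2
      exact (Submodule.Quotient.mk_eq_zero V).1 hx
    | add x y hx hy => rw [map_add, map_add]; exact Submodule.add_mem _ hx hy
  · clear h2 h1 h0
    induction a with
    | zero => simp
    | tmul x y =>
      refine tmul_mem_tensorSub x.2 ?_
      have hy : g' y = 0 := y.2
      exact (Submodule.Quotient.mk_eq_zero W).1 hy
    | add x y hx hy => rw [map_add, map_add]; exact Submodule.add_mem _ hx hy

/-- For an increasing filtration `F 0 = 0 ≤ F 1 ≤ ...`, the elements of `C ⊗ C` that die in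
`C / F a ⊗ C / F b` whenever `a + b = n + 1` are those of `∑_{i + j = n} F (i+1) ⊗ F (j+1)`. -/
theorem mem_iSup_of_forall_map_mkQ_eq_zero {F : ℕ → Submodule k C} (hF : Monotone F)
    (hF0 : F 0 = ⊥) {n : ℕ} {t : C ⊗[k] C}
    (h : ∀ a b, a + b = n + 1 → TensorProduct.map (F a).mkQ (F b).mkQ t = 0) :
    t ∈ ⨆ p ∈ Finset.HasAntidiagonal.antidiagonal n, tensorSub k (F (p.1 + 1)) (F (p.2 + 1)) := by
  set P := ⨆ p ∈ Finset.HasAntidiagonal.antidiagonal n, tensorSub k (F (p.1 + 1)) (F (p.2 + 1)) with hP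
  have hle : ∀ i j, i + j = n → tensorSub k (F (i + 1)) (F (j + 1)) ≤ P := fun i j hij =>
    le_iSup₂_of_le (i, j) (by simpa using hij) le_rfl
  have hbot : ∀ W : Submodule k C, tensorSub k (F 0) W = ⊥ := fun W => by
    rw [hF0, eq_bot_iff]
    refine tensorSub_le fun v hv w _ => ?_
    rw [(Submodule.mem_bot k).1 hv, TensorProduct.zero_tmul]; exact Submodule.zero_mem _
  -- descending induction on `s`
  have key : ∀ d s, s + d = n + 1 → t ∈ tensorSub k (F s) ⊤ ⊔
      ⨆ p ∈ (Finset.HasAntidiagonal.antidiagonal n).filter (fun p => s ≤ p.1),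
        tensorSub k (F (p.1 + 1)) (F (p.2 + 1)) := by
    intro d
    induction d with
    | zero =>
      intro s hs
      obtain rfl : s = n + 1 := hs
      refine Submodule.mem_sup_left ?_
      have h1 := h (n + 1) 0 rfl
      have h2 := mem_sup_of_map_mkQ_eq_zero (U := ⊤) (V := F (n + 1)) (W := F 0) (t := t)
        (by
          refine (?_ : (⊤ : Submodule k (C ⊗[k] C)) ≤ _) trivial
          rw [← TensorProduct.span_tmul_eq_top, Submodule.span_le]
          rintro _ ⟨v, w, rfl⟩
          exact tmul_mem_tensorSub trivial trivial) h1
      refine (sup_le le_rfl ?_ : _ ≤ tensorSub k (F (n + 1)) ⊤) h2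
      rw [hF0]
      refine tensorSub_le fun v _ w hw => ?_
      rw [(Submodule.mem_bot k).1 hw, TensorProduct.tmul_zero]; exact Submodule.zero_mem _
    | succ d ih =>
      intro s hs
      obtain ⟨t1, ht1, t2, ht2, rfl⟩ := Submodule.mem_sup.1 (ih (s + 1) (by omega))
      have h2 : TensorProduct.map (F s).mkQ (F (d + 1)).mkQ t2 = 0 := by
        refine (?_ : _ ≤ LinearMap.ker (TensorProduct.map (F s).mkQ (F (d + 1)).mkQ)) ht2
        refine iSup₂_le fun p hp => tensorSub_le fun v _ w hw => ?_
        simp only [Finset.mem_filter, Finset.HasAntidiagonal.mem_antidiagonal] at hp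
        have hw' : (F (d + 1)).mkQ w = 0 :=
          (Submodule.Quotient.mk_eq_zero _).2 (hF (by omega : p.2 + 1 ≤ d + 1) hw)
        rw [LinearMap.mem_ker, TensorProduct.map_tmul, hw', TensorProduct.tmul_zero]
      have h1 := h s (d + 1) hs
      rw [map_add, h2, add_zero] at h1
      have h3 := mem_sup_of_map_mkQ_eq_zero ht1 h1
      refine Submodule.add_mem _ ?_ ?_
      · refine SetLike.le_def.1 (sup_le le_sup_left (le_sup_of_le_right ?_)) h3
        exact le_iSup₂_of_le (s, d) (by simp; omega) le_rfl
      · refine SetLike.le_def.1 (le_sup_of_le_right ?_) ht2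
        refine iSup₂_le fun p hp => le_iSup₂_of_le p ?_ le_rfl
        simp only [Finset.mem_filter, Finset.HasAntidiagonal.mem_antidiagonal] at hp ⊢
        omega
  have h0 := key (n + 1) 0 (by omega)
  rw [hbot, bot_sup_eq] at h0
  refine (iSup₂_le fun p hp => ?_ : _ ≤ P) h0
  simp only [Finset.mem_filter, Finset.HasAntidiagonal.mem_antidiagonal] at hp
  exact hle _ _ hp.1

theorem map_mkQ_eq_zero_of_mem {V W : Submodule k C} {t : C ⊗[k] C}
    (ht : t ∈ tensorSub k V ⊤ ⊔ tensorSub k ⊤ W) : TensorProduct.map V.mkQ W.mkQ t = 0 := by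
  refine (sup_le (tensorSub_le ?_) (tensorSub_le ?_) :
    _ ≤ LinearMap.ker (TensorProduct.map V.mkQ W.mkQ)) ht
  · intro v hv w _
    have : V.mkQ v = 0 := (Submodule.Quotient.mk_eq_zero _).2 hv
    rw [LinearMap.mem_ker, TensorProduct.map_tmul, this, TensorProduct.zero_tmul]
  · intro v _ w hw
    have : W.mkQ w = 0 := (Submodule.Quotient.mk_eq_zero _).2 hw
    rw [LinearMap.mem_ker, TensorProduct.map_tmul, this, TensorProduct.tmul_zero]

variable (k) [Coalgebra k C]

/-- A subspace `D` with `Δ(D) ⊆ D ⊗ D`. -/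
def IsSubcoalgebra (D : Submodule k C) : Prop :=
  ∀ d ∈ D, Coalgebra.comul (R := k) d ∈ tensorSub k D D

/-- A nonzero subcoalgebra whose only subcoalgebras are `0` and itself. -/
def IsSimpleSubcoalgebra (D : Submodule k C) : Prop :=
  IsSubcoalgebra k D ∧ D ≠ ⊥ ∧ ∀ E : Submodule k C, IsSubcoalgebra k E → E ≤ D → E = ⊥ ∨ E = D

variable (C) in
/-- The coradical of `C`: the sum of its simple subcoalgebras. -/
def coradical : Submodule k C := sSup {D | IsSimpleSubcoalgebra k D}

/-- The wedge `V ∧ W`, the kernel of `C → C ⊗ C → C/V ⊗ C/W`; that is,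
`Δ⁻¹(V ⊗ C + C ⊗ W)`. -/
def wedge (V W : Submodule k C) : Submodule k C :=
  LinearMap.ker (TensorProduct.map V.mkQ W.mkQ ∘ₗ Coalgebra.comul (R := k))

variable (C) in
/-- The coradical filtration `C₀ ⊆ C₁ ⊆ ...`, where `C₀` is the coradical and
`C_{n+1} = C_n ∧ C₀`. -/
def coradFil : ℕ → Submodule k C
  | 0 => coradical k C
  | n + 1 => wedge k (coradFil n) (coradical k C)

variable (C) in
/-- The shifted filtration `n ↦ C_{n-1}`, with `C_{-1} = 0`. -/
def coradFilPred : ℕ → Submodule k C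
  | 0 => ⊥
  | n + 1 => coradFil k C n

variable {k}

theorem mem_wedge {V W : Submodule k C} {c : C} :
    c ∈ wedge k V W ↔ TensorProduct.map V.mkQ W.mkQ (Coalgebra.comul (R := k) c) = 0 := Iff.rfl

theorem wedge_mono {V V' W W' : Submodule k C} (h : V ≤ V') (h' : W ≤ W') :
    wedge k V W ≤ wedge k V' W' := by
  intro c hc
  rw [mem_wedge] at hc ⊢
  have e : TensorProduct.map V'.mkQ W'.mkQ =
      TensorProduct.map (Submodule.factor h) (Submodule.factor h') ∘ₗ
        TensorProduct.map V.mkQ W.mkQ := by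
    ext; rfl
  rw [e, LinearMap.comp_apply, hc, map_zero]

theorem wedge_assoc (U V W : Submodule k C) :
    wedge k (wedge k U V) W = wedge k U (wedge k V W) := by
  let Δ := Coalgebra.comul (R := k) (A := C)
  let f := (wedge k U V).liftQ (TensorProduct.map U.mkQ V.mkQ ∘ₗ Δ) le_rfl
  let g := (wedge k V W).liftQ (TensorProduct.map V.mkQ W.mkQ ∘ₗ Δ) le_rfl
  have hf : Function.Injective f := LinearMap.ker_eq_bot.1 (Submodule.ker_liftQ_eq_bot _ _ _ le_rfl)
  have hg : Function.Injective g := LinearMap.ker_eq_bot.1 (Submodule.ker_liftQ_eq_bot _ _ _ le_rfl)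
  have hf' : Function.Injective (f.rTensor (C ⧸ W)) :=
    Module.Flat.rTensor_preserves_injective_linearMap _ hf
  have hg' : Function.Injective (g.lTensor (C ⧸ U)) :=
    Module.Flat.lTensor_preserves_injective_linearMap _ hg
  ext c
  rw [mem_wedge, mem_wedge, ← map_eq_zero_iff _ hf', ← map_eq_zero_iff _ hg',
    ← (TensorProduct.assoc k (C ⧸ U) (C ⧸ V) (C ⧸ W)).map_eq_zero_iff]
  have e1 : f.rTensor (C ⧸ W) ∘ₗ TensorProduct.map (wedge k U V).mkQ W.mkQ =
      TensorProduct.map (TensorProduct.map U.mkQ V.mkQ) W.mkQ ∘ₗ Δ.rTensor C := by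
    ext; rfl
  have e2 : g.lTensor (C ⧸ U) ∘ₗ TensorProduct.map U.mkQ (wedge k V W).mkQ =
      TensorProduct.map U.mkQ (TensorProduct.map V.mkQ W.mkQ) ∘ₗ Δ.lTensor C := by
    ext; rfl
  have e3 : (TensorProduct.assoc k (C ⧸ U) (C ⧸ V) (C ⧸ W)).toLinearMap ∘ₗ
      TensorProduct.map (TensorProduct.map U.mkQ V.mkQ) W.mkQ =
      TensorProduct.map U.mkQ (TensorProduct.map V.mkQ W.mkQ) ∘ₗ
        (TensorProduct.assoc k C C C).toLinearMap := by
    ext; rfl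
  have h1 := LinearMap.congr_fun e1 (Δ c)
  have h2 := LinearMap.congr_fun e2 (Δ c)
  have h3 := LinearMap.congr_fun e3 (Δ.rTensor C (Δ c))
  simp only [LinearMap.comp_apply, LinearEquiv.coe_coe] at h1 h2 h3
  rw [h1, h2, h3, Coalgebra.coassoc_apply]

theorem isSubcoalgebra_coradical : IsSubcoalgebra k (coradical k C) := by
  intro d hd
  refine (sSup_le fun D hD d hd => ?_ :
    coradical k C ≤ (tensorSub k (coradical k C) (coradical k C)).comap Coalgebra.comul) hd
  exact tensorSub_mono (le_sSup hD) (le_sSup hD) (hD.1 d hd)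

theorem wedge_bot_le (V : Submodule k C) : wedge k V ⊥ ≤ V := by
  intro c hc
  rw [mem_wedge] at hc
  let e : (C ⧸ (⊥ : Submodule k C)) →ₗ[k] k :=
    (⊥ : Submodule k C).liftQ (Coalgebra.counit (R := k)) bot_le
  have h : (TensorProduct.rid k (C ⧸ V)) (TensorProduct.map LinearMap.id e
      (TensorProduct.map V.mkQ (⊥ : Submodule k C).mkQ (Coalgebra.comul (R := k) c))) =
      V.mkQ c := by
    have e1 : TensorProduct.map LinearMap.id e ∘ₗ
        TensorProduct.map V.mkQ (⊥ : Submodule k C).mkQ =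
        V.mkQ.rTensor k ∘ₗ (Coalgebra.counit (R := k) (A := C)).lTensor C := by
      ext; rfl
    have := LinearMap.congr_fun e1 (Coalgebra.comul (R := k) c)
    simp only [LinearMap.comp_apply] at this
    rw [this, Coalgebra.lTensor_counit_comul]
    simp
  rw [hc, map_zero, map_zero] at h
  exact (Submodule.Quotient.mk_eq_zero V).1 h.symm

theorem bot_wedge_le (V : Submodule k C) : wedge k ⊥ V ≤ V := by
  intro c hc
  rw [mem_wedge] at hc
  let e : (C ⧸ (⊥ : Submodule k C)) →ₗ[k] k :=
    (⊥ : Submodule k C).liftQ (Coalgebra.counit (R := k)) bot_le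
  have h : (TensorProduct.lid k (C ⧸ V)) (TensorProduct.map e LinearMap.id
      (TensorProduct.map (⊥ : Submodule k C).mkQ V.mkQ (Coalgebra.comul (R := k) c))) =
      V.mkQ c := by
    have e1 : TensorProduct.map e LinearMap.id ∘ₗ
        TensorProduct.map (⊥ : Submodule k C).mkQ V.mkQ =
        V.mkQ.lTensor k ∘ₗ (Coalgebra.counit (R := k) (A := C)).rTensor C := by
      ext; rfl
    have := LinearMap.congr_fun e1 (Coalgebra.comul (R := k) c)
    simp only [LinearMap.comp_apply] at this
    rw [this, Coalgebra.rTensor_counit_comul]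
    simp
  rw [hc, map_zero, map_zero] at h
  exact (Submodule.Quotient.mk_eq_zero V).1 h.symm

theorem coradical_wedge_bot : wedge k (coradical k C) ⊥ = coradical k C := by
  refine le_antisymm (wedge_bot_le _) fun c hc => ?_
  exact map_mkQ_eq_zero_of_mem (Submodule.mem_sup_left
    (tensorSub_mono le_rfl le_top (isSubcoalgebra_coradical c hc)))

theorem bot_wedge_coradical : wedge k ⊥ (coradical k C) = coradical k C := by
  refine le_antisymm (bot_wedge_le _) fun c hc => ?_
  exact map_mkQ_eq_zero_of_mem (Submodule.mem_sup_right
    (tensorSub_mono le_top le_rfl (isSubcoalgebra_coradical c hc)))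

theorem coradFilPred_succ (n : ℕ) :
    coradFilPred k C (n + 1) = wedge k (coradFilPred k C n) (coradical k C) := by
  cases n with
  | zero => exact bot_wedge_coradical.symm
  | succ n => rfl

theorem coradFilPred_wedge_bot (n : ℕ) :
    wedge k (coradFilPred k C n) ⊥ = coradFilPred k C n := by
  cases n with
  | zero => exact le_antisymm (wedge_bot_le _) bot_le
  | succ n => rw [coradFilPred_succ, wedge_assoc, coradical_wedge_bot]

/-- With `F n = C_{n-1}` one has `F (a + b) = F a ∧ F b`. -/
theorem coradFilPred_add (a b : ℕ) :
    coradFilPred k C (a + b) = wedge k (coradFilPred k C a) (coradFilPred k C b) := by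
  induction b with
  | zero => exact (coradFilPred_wedge_bot a).symm
  | succ b ih => rw [coradFilPred_succ b, ← wedge_assoc, ← ih, ← coradFilPred_succ]; rfl

theorem coradFilPred_mono : Monotone (coradFilPred k C) := by
  refine monotone_nat_of_le_succ fun n => ?_
  rw [coradFilPred_succ]
  exact (coradFilPred_wedge_bot n).ge.trans (wedge_mono le_rfl bot_le)

theorem coradFil_mono : Monotone (coradFil k C) := fun _ _ h =>
  coradFilPred_mono (Nat.succ_le_succ h)

theorem coradFilPred_le (n : ℕ) : coradFilPred k C n ≤ coradFil k C n :=
  coradFilPred_mono (Nat.le_succ n)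

theorem mem_coradFilPred_of_lt {i j : ℕ} (h : i < j) {c : C} (hc : c ∈ coradFil k C i) :
    c ∈ coradFilPred k C j :=
  coradFilPred_mono (Nat.succ_le_of_lt h) hc

/-- `Δ(C_n) ⊆ ∑_{i + j = n} C_i ⊗ C_j`. -/
theorem comul_mem_iSup {n : ℕ} {c : C} (hc : c ∈ coradFil k C n) :
    Coalgebra.comul (R := k) c ∈
      ⨆ p ∈ Finset.HasAntidiagonal.antidiagonal n, tensorSub k (coradFil k C p.1) (coradFil k C p.2) := by
  refine mem_iSup_of_forall_map_mkQ_eq_zero (F := coradFilPred k C) coradFilPred_mono rfl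
    fun a b hab => ?_
  rw [← mem_wedge, ← coradFilPred_add, hab]
  exact hc

/-- To prove a linear condition on `Δ c`, `c ∈ C_n`, it is enough to check it on `u ⊗ v` with
`u ∈ C_i`, `v ∈ C_j`, `i + j = n`. -/
theorem comul_mem_of_forall {n : ℕ} {P : Submodule k (C ⊗[k] C)}
    (h : ∀ i j, i + j = n → ∀ u ∈ coradFil k C i, ∀ v ∈ coradFil k C j, u ⊗ₜ[k] v ∈ P)
    {c : C} (hc : c ∈ coradFil k C n) : Coalgebra.comul (R := k) c ∈ P := by
  refine (iSup₂_le fun p hp => ?_ : _ ≤ P) (comul_mem_iSup hc)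
  exact tensorSub_le (h _ _ (by simpa using hp))

end Coalgebras

section GradedSpace

variable (k : Type u) [Field k] (C : Type v) [AddCommGroup C] [Module k C] [Coalgebra k C]

/-- The homogeneous component `C_n / C_{n-1}`. -/
abbrev grPiece (n : ℕ) : Type v :=
  ↥(coradFil k C n) ⧸ (coradFilPred k C n).submoduleOf (coradFil k C n)

/-- The underlying space `gr C = ⨁ n, C_n / C_{n-1}` of the associated graded coalgebra. -/
def Gr : Type v := DirectSum ℕ (grPiece k C)

instance : AddCommGroup (Gr k C) := inferInstanceAs (AddCommGroup (DirectSum ℕ (grPiece k C)))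

instance : Module k (Gr k C) := inferInstanceAs (Module k (DirectSum ℕ (grPiece k C)))

variable {C}

/-- The inclusion `C_n / C_{n-1} ⊆ gr C`. -/
def grOf (n : ℕ) : grPiece k C n →ₗ[k] Gr k C := DirectSum.lof k ℕ (grPiece k C) n

/-- The map `C_n → C_n / C_{n-1} ⊆ gr C`. -/
def grMk (n : ℕ) : coradFil k C n →ₗ[k] Gr k C :=
  grOf k n ∘ₗ
    ((coradFilPred k C n).submoduleOf (coradFil k C n)).mkQ

variable {k}

theorem grMk_congr {m n : ℕ} (h : m = n) {x : coradFil k C m} {y : coradFil k C n}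
    (hxy : (x : C) = y) : grMk k m x = grMk k n y := by
  subst h
  rw [Subtype.ext hxy]

theorem grMk_eq_zero {n : ℕ} {x : coradFil k C n} (h : (x : C) ∈ coradFilPred k C n) :
    grMk k n x = 0 := by
  have : ((coradFilPred k C n).submoduleOf (coradFil k C n)).mkQ x = 0 :=
    (Submodule.Quotient.mk_eq_zero _).2 h
  rw [grMk, LinearMap.comp_apply, this, map_zero]

/-- The linear map on `gr C` given by linear maps on the `C_n` that vanish on `C_{n-1}`. -/
def grLift {M : Type*} [AddCommGroup M] [Module k M] (f : ∀ n, coradFil k C n →ₗ[k] M)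
    (hf : ∀ n (x : coradFil k C n), (x : C) ∈ coradFilPred k C n → f n x = 0) : Gr k C →ₗ[k] M :=
  DirectSum.toModule k ℕ M fun n =>
    ((coradFilPred k C n).submoduleOf (coradFil k C n)).liftQ (f n) fun x hx => hf n x hx

@[simp]
theorem grLift_grMk {M : Type*} [AddCommGroup M] [Module k M] (f : ∀ n, coradFil k C n →ₗ[k] M)
    (hf : ∀ n (x : coradFil k C n), (x : C) ∈ coradFilPred k C n → f n x = 0) (n : ℕ) (x : coradFil k C n) :
    grLift f hf (grMk k n x) = f n x := by
  exact DirectSum.toModule_lof k n _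

theorem gr_hom_ext {M : Type*} [AddCommGroup M] [Module k M] {f g : Gr k C →ₗ[k] M}
    (h : ∀ n x, f (grMk k n x) = g (grMk k n x)) : f = g := by
  refine DirectSum.linearMap_ext k fun n => ?_
  refine LinearMap.ext fun x => ?_
  obtain ⟨x, rfl⟩ := Submodule.mkQ_surjective _ x
  exact h n x

theorem exists_grExt (n : ℕ) :
    ∃ e : C →ₗ[k] grPiece k C n, e ∘ₗ (coradFil k C n).subtype =
      ((coradFilPred k C n).submoduleOf (coradFil k C n)).mkQ :=
  LinearMap.exists_extend _

variable (k) in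
/-- A linear map `C → gr C` that extends the projection `C_n → C_n / C_{n-1}`.  The
comultiplication of `gr C` does not depend on its choice, see `grComul_grMk`. -/
def grExt (n : ℕ) : C →ₗ[k] Gr k C :=
  grOf k n ∘ₗ (exists_grExt (k := k) (C := C) n).choose

theorem grExt_eq {n : ℕ} {c : C} (hc : c ∈ coradFil k C n) : grExt k n c = grMk k n ⟨c, hc⟩ := by
  have := LinearMap.congr_fun (exists_grExt (k := k) (C := C) n).choose_spec ⟨c, hc⟩
  rw [grExt, LinearMap.comp_apply]
  exact congrArg _ this

theorem grExt_eq_zero {n : ℕ} {c : C} (hc : c ∈ coradFilPred k C n) : grExt k n c = 0 := by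
  rw [grExt_eq (coradFilPred_le n hc), grMk_eq_zero hc]

variable (k C) in
/-- The degree `n` part `∑_{i + j = n} p_i ⊗ p_j` of the projection to `gr C ⊗ gr C`. -/
def grTensor (n : ℕ) : C ⊗[k] C →ₗ[k] Gr k C ⊗[k] Gr k C :=
  ∑ p ∈ Finset.HasAntidiagonal.antidiagonal n, TensorProduct.map (grExt k p.1) (grExt k p.2)

theorem grExt_tmul_grExt_eq_zero {i j a b : ℕ} {u v : C} (hu : u ∈ coradFil k C i)
    (hv : v ∈ coradFil k C j) (h : i < a ∨ j < b) :
    grExt k a u ⊗ₜ[k] grExt k b v = 0 := by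
  rcases h with h | h
  · rw [grExt_eq_zero (mem_coradFilPred_of_lt h hu), TensorProduct.zero_tmul]
  · rw [grExt_eq_zero (mem_coradFilPred_of_lt h hv), TensorProduct.tmul_zero]

theorem grTensor_tmul {n i j : ℕ} (h : i + j = n) {u v : C} (hu : u ∈ coradFil k C i)
    (hv : v ∈ coradFil k C j) :
    grTensor k C n (u ⊗ₜ v) = grMk k i ⟨u, hu⟩ ⊗ₜ grMk k j ⟨v, hv⟩ := by
  rw [grTensor, LinearMap.sum_apply, Finset.sum_eq_single (i, j)]
  · rw [TensorProduct.map_tmul, grExt_eq hu, grExt_eq hv]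
  · intro p hp hne
    rw [Finset.HasAntidiagonal.mem_antidiagonal] at hp
    refine grExt_tmul_grExt_eq_zero hu hv ?_
    by_contra hcon
    exact hne (Prod.ext (by omega) (by omega))
  · intro hne
    exact absurd (Finset.HasAntidiagonal.mem_antidiagonal.2 h) hne

theorem grTensor_comul_eq_zero {n : ℕ} {c : C} (hc : c ∈ coradFilPred k C n) :
    grTensor k C n (Coalgebra.comul (R := k) c) = 0 := by
  cases n with
  | zero =>
    have : c = 0 := hc
    rw [this, map_zero, map_zero]
  | succ n =>
    refine comul_mem_of_forall (P := LinearMap.ker (grTensor k C (n + 1))) ?_ hc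
    intro i j hij u hu v hv
    rw [LinearMap.mem_ker, grTensor, LinearMap.sum_apply]
    refine Finset.sum_eq_zero fun p hp => ?_
    rw [Finset.HasAntidiagonal.mem_antidiagonal] at hp
    exact grExt_tmul_grExt_eq_zero hu hv (by omega)

variable (k C) in
/-- The comultiplication of `gr C`. -/
def grComul : Gr k C →ₗ[k] Gr k C ⊗[k] Gr k C :=
  grLift (fun n => grTensor k C n ∘ₗ Coalgebra.comul (R := k) ∘ₗ (coradFil k C n).subtype)
    fun _ _ hx => grTensor_comul_eq_zero hx

variable (k C) in
/-- The counit of `gr C`: the counit of `C` on `C_0`, and zero in positive degrees. -/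
def grCounit : Gr k C →ₗ[k] k :=
  grLift (fun n => match n with
    | 0 => Coalgebra.counit (R := k) ∘ₗ (coradFil k C 0).subtype
    | _ + 1 => 0) fun n x hx => by
      cases n with
      | zero =>
        have h : (x : C) = 0 := hx
        obtain rfl : x = 0 := Subtype.ext h
        exact map_zero _
      | succ n => rfl

theorem grComul_grMk_eq (n : ℕ) (x : coradFil k C n) :
    grComul k C (grMk k n x) = grTensor k C n (Coalgebra.comul (R := k) (x : C)) := by
  rw [grComul, grLift_grMk]; rfl

/-- If `Δ x = ∑ u_s ⊗ v_s` with `x ∈ C_n`, `u_s ∈ C_{i_s}`, `v_s ∈ C_{j_s}`, `i_s + j_s = n`,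
then the comultiplication of `gr C` takes the class of `x` to the sum of the tensor products of the
classes of `u_s` and `v_s`. -/
theorem grComul_grMk {ι : Type*} (s : Finset ι) (n : ℕ) (x : coradFil k C n) (i j : ι → ℕ)
    (hij : ∀ a ∈ s, i a + j a = n) (u : ∀ a, coradFil k C (i a)) (v : ∀ a, coradFil k C (j a))
    (hx : Coalgebra.comul (R := k) (x : C) = ∑ a ∈ s, (u a : C) ⊗ₜ[k] (v a : C)) :
    grComul k C (grMk k n x) = ∑ a ∈ s, grMk k (i a) (u a) ⊗ₜ[k] grMk k (j a) (v a) := by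
  rw [grComul_grMk_eq, hx, map_sum]
  exact Finset.sum_congr rfl fun a ha => grTensor_tmul (hij a ha) (u a).2 (v a).2

@[simp]
theorem grCounit_grMk_zero (x : coradFil k C 0) :
    grCounit k C (grMk k 0 x) = Coalgebra.counit (R := k) (x : C) := by
  rw [grCounit, grLift_grMk]; rfl

@[simp]
theorem grCounit_grMk_succ (n : ℕ) (x : coradFil k C (n + 1)) :
    grCounit k C (grMk k (n + 1) x) = 0 := by
  rw [grCounit, grLift_grMk]; rfl

theorem grCounit_grMk_of_pos {n : ℕ} (hn : 0 < n) (x : coradFil k C n) :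
    grCounit k C (grMk k n x) = 0 := by
  obtain ⟨n, rfl⟩ := Nat.exists_eq_succ_of_ne_zero hn.ne'
  exact grCounit_grMk_succ n x

variable (k C) in
/-- The degree `n` part of the projection to `gr C ⊗ (gr C ⊗ gr C)`. -/
def grTensor₃ (n : ℕ) : C ⊗[k] (C ⊗[k] C) →ₗ[k] Gr k C ⊗[k] (Gr k C ⊗[k] Gr k C) :=
  ∑ p ∈ Finset.HasAntidiagonal.antidiagonal n,
    TensorProduct.map (grExt k p.1) (grTensor k C p.2)

theorem grTensor₃_tmul {n a b c : ℕ} (h : a + (b + c) = n) {u v w : C}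
    (hu : u ∈ coradFil k C a) (hv : v ∈ coradFil k C b) (hw : w ∈ coradFil k C c) :
    grTensor₃ k C n (u ⊗ₜ (v ⊗ₜ w)) =
      grMk k a ⟨u, hu⟩ ⊗ₜ (grMk k b ⟨v, hv⟩ ⊗ₜ grMk k c ⟨w, hw⟩) := by
  rw [grTensor₃, LinearMap.sum_apply, Finset.sum_eq_single (a, b + c)]
  · rw [TensorProduct.map_tmul, grExt_eq hu, grTensor_tmul rfl hv hw]
  · intro p hp hne
    rw [Finset.HasAntidiagonal.mem_antidiagonal] at hp
    rw [TensorProduct.map_tmul]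
    rcases lt_or_ge a p.1 with hlt | hge
    · rw [grExt_eq_zero (mem_coradFilPred_of_lt hlt hu), TensorProduct.zero_tmul]
    · have hlt : b + c < p.2 := by
        rcases hge.lt_or_eq with h' | h'
        · omega
        · exact absurd (Prod.ext h' (by omega)) hne
      have h0 : grTensor k C p.2 (v ⊗ₜ w) = 0 := by
        rw [grTensor, LinearMap.sum_apply]
        refine Finset.sum_eq_zero fun q hq => ?_
        rw [Finset.HasAntidiagonal.mem_antidiagonal] at hq
        exact grExt_tmul_grExt_eq_zero hv hw (by omega)
      rw [h0, TensorProduct.tmul_zero]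
  · intro hne
    exact absurd (Finset.HasAntidiagonal.mem_antidiagonal.2 h) hne

theorem grComul_coassoc :
    (TensorProduct.assoc k (Gr k C) (Gr k C) (Gr k C)).toLinearMap ∘ₗ
      (grComul k C).rTensor (Gr k C) ∘ₗ grComul k C =
    (grComul k C).lTensor (Gr k C) ∘ₗ grComul k C := by
  refine gr_hom_ext fun n x => ?_
  simp only [LinearMap.comp_apply, LinearEquiv.coe_coe, grComul_grMk_eq]
  have h1 : TensorProduct.assoc k (Gr k C) (Gr k C) (Gr k C) ((grComul k C).rTensor (Gr k C)
      (grTensor k C n (Coalgebra.comul (R := k) (x : C)))) =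
      grTensor₃ k C n (TensorProduct.assoc k C C C
        ((Coalgebra.comul (R := k) (A := C)).rTensor C (Coalgebra.comul (R := k) (x : C)))) := by
    refine comul_mem_of_forall (P := LinearMap.eqLocus
      ((TensorProduct.assoc k (Gr k C) (Gr k C) (Gr k C)).toLinearMap ∘ₗ
        (grComul k C).rTensor (Gr k C) ∘ₗ grTensor k C n)
      (grTensor₃ k C n ∘ₗ (TensorProduct.assoc k C C C).toLinearMap ∘ₗ
        (Coalgebra.comul (R := k) (A := C)).rTensor C)) ?_ x.2
    intro i j hij u hu v hv
    simp only [LinearMap.mem_eqLocus, LinearMap.comp_apply, LinearEquiv.coe_coe]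
    rw [grTensor_tmul hij hu hv, LinearMap.rTensor_tmul, LinearMap.rTensor_tmul, grComul_grMk_eq]
    refine comul_mem_of_forall (P := LinearMap.eqLocus
      ((TensorProduct.assoc k (Gr k C) (Gr k C) (Gr k C)).toLinearMap ∘ₗ
        ((TensorProduct.mk k _ _).flip (grMk k j ⟨v, hv⟩)) ∘ₗ grTensor k C i)
      (grTensor₃ k C n ∘ₗ (TensorProduct.assoc k C C C).toLinearMap ∘ₗ
        ((TensorProduct.mk k _ _).flip v))) ?_ hu
    intro a b hab w hw z hz
    simp only [LinearMap.mem_eqLocus, LinearMap.comp_apply, LinearEquiv.coe_coe,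
      LinearMap.flip_apply, TensorProduct.mk_apply]
    rw [grTensor_tmul hab hw hz, TensorProduct.assoc_tmul, TensorProduct.assoc_tmul,
      grTensor₃_tmul (by omega) hw hz hv]
  have h2 : (grComul k C).lTensor (Gr k C)
      (grTensor k C n (Coalgebra.comul (R := k) (x : C))) =
      grTensor₃ k C n
        ((Coalgebra.comul (R := k) (A := C)).lTensor C (Coalgebra.comul (R := k) (x : C))) := by
    refine comul_mem_of_forall (P := LinearMap.eqLocus
      ((grComul k C).lTensor (Gr k C) ∘ₗ grTensor k C n)
      (grTensor₃ k C n ∘ₗ (Coalgebra.comul (R := k) (A := C)).lTensor C)) ?_ x.2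
    intro i j hij u hu v hv
    simp only [LinearMap.mem_eqLocus, LinearMap.comp_apply]
    rw [grTensor_tmul hij hu hv, LinearMap.lTensor_tmul, LinearMap.lTensor_tmul, grComul_grMk_eq]
    refine comul_mem_of_forall (P := LinearMap.eqLocus
      (TensorProduct.mk k (Gr k C) (Gr k C ⊗[k] Gr k C) (grMk k i ⟨u, hu⟩) ∘ₗ grTensor k C j)
      (grTensor₃ k C n ∘ₗ TensorProduct.mk k C (C ⊗[k] C) u)) ?_ hv
    intro a b hab w hw z hz
    simp only [LinearMap.mem_eqLocus, LinearMap.comp_apply, TensorProduct.mk_apply]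
    rw [grTensor_tmul hab hw hz, grTensor₃_tmul (by omega) hu hw hz]
  rw [h1, h2, Coalgebra.coassoc_apply]

theorem grCounit_rTensor :
    (grCounit k C).rTensor (Gr k C) ∘ₗ grComul k C = TensorProduct.mk k _ _ 1 := by
  refine gr_hom_ext fun n x => ?_
  rw [LinearMap.comp_apply, grComul_grMk_eq]
  have h : (grCounit k C).rTensor (Gr k C)
      (grTensor k C n (Coalgebra.comul (R := k) (x : C))) =
      (grExt k n).lTensor k ((Coalgebra.counit (R := k) (A := C)).rTensor C
        (Coalgebra.comul (R := k) (x : C))) := by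
    refine comul_mem_of_forall (P := LinearMap.eqLocus
      ((grCounit k C).rTensor (Gr k C) ∘ₗ grTensor k C n)
      ((grExt k n).lTensor k ∘ₗ (Coalgebra.counit (R := k) (A := C)).rTensor C)) ?_ x.2
    intro i j hij u hu v hv
    simp only [LinearMap.mem_eqLocus, LinearMap.comp_apply]
    rw [grTensor_tmul hij hu hv, LinearMap.rTensor_tmul, LinearMap.rTensor_tmul,
      LinearMap.lTensor_tmul]
    rcases Nat.eq_zero_or_pos i with rfl | hi
    · obtain rfl : j = n := by omega
      rw [grCounit_grMk_zero, grExt_eq hv]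
    · rw [grCounit_grMk_of_pos hi, grExt_eq_zero (mem_coradFilPred_of_lt (by omega) hv),
        TensorProduct.zero_tmul, TensorProduct.tmul_zero]
  rw [h, Coalgebra.rTensor_counit_comul, LinearMap.lTensor_tmul, grExt_eq x.2]
  rfl

theorem grCounit_lTensor :
    (grCounit k C).lTensor (Gr k C) ∘ₗ grComul k C = (TensorProduct.mk k _ _).flip 1 := by
  refine gr_hom_ext fun n x => ?_
  rw [LinearMap.comp_apply, grComul_grMk_eq]
  have h : (grCounit k C).lTensor (Gr k C)
      (grTensor k C n (Coalgebra.comul (R := k) (x : C))) =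
      (grExt k n).rTensor k ((Coalgebra.counit (R := k) (A := C)).lTensor C
        (Coalgebra.comul (R := k) (x : C))) := by
    refine comul_mem_of_forall (P := LinearMap.eqLocus
      ((grCounit k C).lTensor (Gr k C) ∘ₗ grTensor k C n)
      ((grExt k n).rTensor k ∘ₗ (Coalgebra.counit (R := k) (A := C)).lTensor C)) ?_ x.2
    intro i j hij u hu v hv
    simp only [LinearMap.mem_eqLocus, LinearMap.comp_apply]
    rw [grTensor_tmul hij hu hv, LinearMap.lTensor_tmul, LinearMap.lTensor_tmul,
      LinearMap.rTensor_tmul]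
    rcases Nat.eq_zero_or_pos j with rfl | hj
    · obtain rfl : i = n := by omega
      rw [grCounit_grMk_zero, grExt_eq hu]
    · rw [grCounit_grMk_of_pos hj, grExt_eq_zero (mem_coradFilPred_of_lt (by omega) hu),
        TensorProduct.zero_tmul, TensorProduct.tmul_zero]
  rw [h, Coalgebra.lTensor_counit_comul, LinearMap.rTensor_tmul, grExt_eq x.2]
  rfl

/-- The associated graded coalgebra of the coradical filtration. -/
instance : Coalgebra k (Gr k C) where
  comul := grComul k C
  counit := grCounit k C
  coassoc := grComul_coassoc
  rTensor_counit_comp_comul := grCounit_rTensor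
  lTensor_counit_comp_comul := grCounit_lTensor

theorem comul_grMk (n : ℕ) (x : coradFil k C n) :
    Coalgebra.comul (R := k) (grMk k n x) =
      grTensor k C n (Coalgebra.comul (R := k) (x : C)) := grComul_grMk_eq n x

end GradedSpace

section HopfAlgebras

variable (k : Type u) [Field k] (H : Type v) [Ring H] [HopfAlgebra k H]

variable {H} in
/-- A Hopf subalgebra: a subspace that contains `1` and is closed under multiplication,
comultiplication and the antipode. -/
structure IsHopfSubalgebra (K : Submodule k H) : Prop where
  one_mem : (1 : H) ∈ K
  mul_mem : ∀ x ∈ K, ∀ y ∈ K, x * y ∈ K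
  isSubcoalgebra : IsSubcoalgebra k K
  antipode_mem : ∀ x ∈ K, HopfAlgebra.antipode k x ∈ K

/-- The condition that the coradical of `H` is a Hopf subalgebra of `H`. -/
class HasHopfCoradical : Prop where
  isHopfSubalgebra : IsHopfSubalgebra k (coradical k H)

/-- A Hopf algebra is co-Frobenius if it has a nonzero left integral: a nonzero `T : H → k` with
`α T = α(1) T` for all `α : H → k`, where `(α T)(h) = ∑ α(h₁) T(h₂)`. -/
def IsCoFrobenius : Prop :=
  ∃ T : H →ₗ[k] k, T ≠ 0 ∧ ∀ α : H →ₗ[k] k,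
    LinearMap.mul' k k ∘ₗ TensorProduct.map α T ∘ₗ Coalgebra.comul = α 1 • T

variable {k H}

/-! The antipode is an anti-morphism of coalgebras. -/

theorem swap_antipode_mul_comul (c : H) :
    LinearMap.mul' k (H ⊗[k] H) (TensorProduct.map
      (TensorProduct.map (HopfAlgebra.antipode k) (HopfAlgebra.antipode k) ∘ₗ
        (TensorProduct.comm k H H).toLinearMap ∘ₗ Coalgebra.comul) Coalgebra.comul
      (Coalgebra.comul (R := k) c)) = algebraMap k (H ⊗[k] H) (Coalgebra.counit (R := k) c) := by
  let S := HopfAlgebra.antipode k (A := H)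
  let Δ := Coalgebra.comul (R := k) (A := H)
  -- `A ((x ⊗ y) ⊗ t) = (S y ⊗ S x) * t`
  let A : (H ⊗[k] H) ⊗[k] (H ⊗[k] H) →ₗ[k] H ⊗[k] H :=
    LinearMap.mul' k (H ⊗[k] H) ∘ₗ
      (TensorProduct.map S S ∘ₗ (TensorProduct.comm k H H).toLinearMap).rTensor (H ⊗[k] H)
  -- `B x (y ⊗ z) = (S y ⊗ S x) * Δ z`
  let B : H → (H ⊗[k] H →ₗ[k] H ⊗[k] H) := fun x =>
    A ∘ₗ (TensorProduct.mk k H H x).rTensor (H ⊗[k] H) ∘ₗ Δ.lTensor H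
  have hB : ∀ x y, B x (Δ y) = 1 ⊗ₜ (S x * y) := by
    intro x y
    -- `D ((a ⊗ b) ⊗ d) = S a * b ⊗ S x * d`
    let D : (H ⊗[k] H) ⊗[k] H →ₗ[k] H ⊗[k] H :=
      TensorProduct.map (LinearMap.mul' k H ∘ₗ S.rTensor H) (LinearMap.mulLeft k (S x))
    have e1 : A ∘ₗ (TensorProduct.mk k H H x).rTensor (H ⊗[k] H) ∘ₗ
        (TensorProduct.assoc k H H H).toLinearMap = D := by
      ext a b d
      simp [A, D]
    have e2 : B x (Δ y) = D (Δ.rTensor H (Δ y)) := by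
      rw [← e1]
      simp only [B, LinearMap.comp_apply, LinearEquiv.coe_coe]
      rw [Coalgebra.coassoc_apply]
    have e3 : D ∘ₗ Δ.rTensor H = TensorProduct.map (Algebra.linearMap k H)
        (LinearMap.mulLeft k (S x)) ∘ₗ (Coalgebra.counit (R := k) (A := H)).rTensor H := by
      ext a d
      simp only [D, Δ, S, TensorProduct.AlgebraTensorModule.curry_apply,
        LinearMap.restrictScalars_self, TensorProduct.curry_apply, LinearMap.comp_apply,
        LinearMap.rTensor_tmul, TensorProduct.map_tmul,
        HopfAlgebra.mul_antipode_rTensor_comul_apply, Algebra.linearMap_apply]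
    rw [e2, ← LinearMap.comp_apply, e3, LinearMap.comp_apply, Coalgebra.rTensor_counit_comul]
    simp
  have h1 : LinearMap.mul' k (H ⊗[k] H) ∘ₗ TensorProduct.map
      (TensorProduct.map S S ∘ₗ (TensorProduct.comm k H H).toLinearMap ∘ₗ Δ) Δ =
      A ∘ₗ Δ.lTensor (H ⊗[k] H) ∘ₗ Δ.rTensor H := by
    ext x y
    simp [A]
  have h2 : A ∘ₗ Δ.lTensor (H ⊗[k] H) ∘ₗ (TensorProduct.assoc k H H H).symm.toLinearMap ∘ₗ
      Δ.lTensor H = TensorProduct.mk k H H 1 ∘ₗ LinearMap.mul' k H ∘ₗ S.rTensor H := by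
    ext x y
    have e : A ∘ₗ Δ.lTensor (H ⊗[k] H) ∘ₗ (TensorProduct.assoc k H H H).symm.toLinearMap ∘ₗ
        TensorProduct.mk k H (H ⊗[k] H) x = B x := by
      ext a b
      simp [B]
    have e' := LinearMap.congr_fun e (Δ y)
    rw [hB] at e'
    simpa using e'
  have h3 := LinearMap.congr_fun h1 (Δ c)
  have h4 := LinearMap.congr_fun h2 (Δ c)
  simp only [LinearMap.comp_apply, LinearEquiv.coe_coe] at h3 h4
  rw [Coalgebra.coassoc_symm_apply, HopfAlgebra.mul_antipode_rTensor_comul_apply] at h4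
  refine h3.trans (h4.trans ?_)
  rw [TensorProduct.mk_apply, Algebra.algebraMap_eq_smul_one, Algebra.algebraMap_eq_smul_one,
    TensorProduct.tmul_smul, Algebra.TensorProduct.one_def]

theorem comul_antipode (c : H) :
    Coalgebra.comul (R := k) (HopfAlgebra.antipode k c) =
      TensorProduct.map (HopfAlgebra.antipode k) (HopfAlgebra.antipode k)
        (TensorProduct.comm k H H (Coalgebra.comul (R := k) c)) := by
  have h : WithConv.toConv (TensorProduct.map (HopfAlgebra.antipode k) (HopfAlgebra.antipode k) ∘ₗ
        (TensorProduct.comm k H H).toLinearMap ∘ₗ Coalgebra.comul (R := k) (A := H)) *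
      WithConv.toConv (Coalgebra.comul (R := k) (A := H)) = 1 := by
    ext c
    exact swap_antipode_mul_comul c
  have h' := left_inv_eq_right_inv h (LinearMap.comul_right_inv (R := k) (C := H))
  exact (LinearMap.congr_fun (WithConv.toConv_injective h') c).symm

section Filtration

variable [hH : HasHopfCoradical k H]

theorem one_mem_coradFil : (1 : H) ∈ coradFil k H 0 := hH.isHopfSubalgebra.one_mem

theorem mul_mem_coradFil {m n : ℕ} {x y : H} (hx : x ∈ coradFil k H m) (hy : y ∈ coradFil k H n) :
    x * y ∈ coradFil k H (m + n) := by
  induction hN : m + n using Nat.strong_induction_on generalizing m n x y with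
  | _ N ih =>
    subst hN
    change x * y ∈ coradFilPred k H (m + n + 1)
    rw [coradFilPred_succ, mem_wedge, Bialgebra.comul_mul]
    refine comul_mem_of_forall (P := LinearMap.ker (TensorProduct.map
      (coradFilPred k H (m + n)).mkQ (coradical k H).mkQ ∘ₗ
        LinearMap.mulRight k (Coalgebra.comul (R := k) y))) ?_ hx
    intro i j hij u hu v hv
    refine comul_mem_of_forall (P := LinearMap.ker (TensorProduct.map
      (coradFilPred k H (m + n)).mkQ (coradical k H).mkQ ∘ₗ
        LinearMap.mulLeft k (u ⊗ₜ[k] v))) ?_ hy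
    intro i' j' hij' u' hu' v' hv'
    rw [LinearMap.mem_ker, LinearMap.comp_apply, LinearMap.mulLeft_apply,
      Algebra.TensorProduct.tmul_mul_tmul]
    by_cases hlt : i + i' < m + n
    · exact map_mkQ_eq_zero_of_mem (Submodule.mem_sup_left (tmul_mem_tensorSub
        (mem_coradFilPred_of_lt hlt (ih _ hlt hu hu' rfl)) trivial))
    · obtain rfl : j = 0 := by omega
      obtain rfl : j' = 0 := by omega
      exact map_mkQ_eq_zero_of_mem (Submodule.mem_sup_right (tmul_mem_tensorSub trivial
        (hH.isHopfSubalgebra.mul_mem v hv v' hv')))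

theorem mul_mem_coradFilPred_left {m n : ℕ} {x y : H} (hx : x ∈ coradFilPred k H m)
    (hy : y ∈ coradFil k H n) : x * y ∈ coradFilPred k H (m + n) := by
  cases m with
  | zero =>
    obtain rfl : x = 0 := hx
    rw [zero_mul]; exact Submodule.zero_mem _
  | succ m =>
    exact mem_coradFilPred_of_lt (by omega : m + n < m + 1 + n) (mul_mem_coradFil hx hy)

theorem mul_mem_coradFilPred_right {m n : ℕ} {x y : H} (hx : x ∈ coradFil k H m)
    (hy : y ∈ coradFilPred k H n) : x * y ∈ coradFilPred k H (m + n) := by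
  cases n with
  | zero =>
    obtain rfl : y = 0 := hy
    rw [mul_zero]; exact Submodule.zero_mem _
  | succ n => exact mul_mem_coradFil hx hy

theorem antipode_mem_coradFilPred {n : ℕ} {x : H} (hx : x ∈ coradFilPred k H n) :
    HopfAlgebra.antipode k x ∈ coradFilPred k H n := by
  induction n generalizing x with
  | zero =>
    obtain rfl : x = 0 := hx
    rw [map_zero]; exact Submodule.zero_mem _
  | succ n ih =>
    rw [coradFilPred_succ, mem_wedge, comul_antipode]
    refine comul_mem_of_forall (P := LinearMap.ker (TensorProduct.map
      (coradFilPred k H n).mkQ (coradical k H).mkQ ∘ₗ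
        TensorProduct.map (HopfAlgebra.antipode k) (HopfAlgebra.antipode k) ∘ₗ
          (TensorProduct.comm k H H).toLinearMap)) ?_ hx
    intro i j hij u hu v hv
    rw [LinearMap.mem_ker, LinearMap.comp_apply, LinearMap.comp_apply, LinearEquiv.coe_coe,
      TensorProduct.comm_tmul, TensorProduct.map_tmul]
    rcases Nat.eq_zero_or_pos i with rfl | hi
    · exact map_mkQ_eq_zero_of_mem (Submodule.mem_sup_right (tmul_mem_tensorSub trivial
        (hH.isHopfSubalgebra.antipode_mem u hu)))
    · exact map_mkQ_eq_zero_of_mem (Submodule.mem_sup_left (tmul_mem_tensorSub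
        (ih (mem_coradFilPred_of_lt (by omega : j < n) hv)) trivial))

theorem antipode_mem_coradFil {n : ℕ} {x : H} (hx : x ∈ coradFil k H n) :
    HopfAlgebra.antipode k x ∈ coradFil k H n := antipode_mem_coradFilPred (n := n + 1) hx

variable (k H) in
/-- The product `H_m × H_n → H_{m+n} → gr H`. -/
def grMulAux (m n : ℕ) : coradFil k H m →ₗ[k] coradFil k H n →ₗ[k] Gr k H :=
  LinearMap.mk₂ k (fun x y => grMk k (m + n) ⟨(x : H) * (y : H), mul_mem_coradFil x.2 y.2⟩)
    (fun x x' y => by rw [← map_add]; exact grMk_congr rfl (add_mul (x : H) x' y))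
    (fun a x y => by rw [← map_smul]; exact grMk_congr rfl (smul_mul_assoc a (x : H) y))
    (fun x y y' => by rw [← map_add]; exact grMk_congr rfl (mul_add (x : H) y y'))
    (fun a x y => by rw [← map_smul]; exact grMk_congr rfl (mul_smul_comm a (x : H) y))

variable (k H) in
/-- The multiplication of `gr H`. -/
def grMul : Gr k H →ₗ[k] Gr k H →ₗ[k] Gr k H :=
  grLift (fun m => (grLift (fun n => (grMulAux k H m n).flip) fun n y hy => by
      ext x
      exact grMk_eq_zero (mul_mem_coradFilPred_right x.2 hy)).flip) fun m x hx => by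
    refine gr_hom_ext fun n y => ?_
    rw [LinearMap.flip_apply, grLift_grMk]
    exact grMk_eq_zero (mul_mem_coradFilPred_left hx y.2)

theorem grMul_grMk (m n : ℕ) (x : coradFil k H m) (y : coradFil k H n) :
    grMul k H (grMk k m x) (grMk k n y) =
      grMk k (m + n) ⟨(x : H) * (y : H), mul_mem_coradFil x.2 y.2⟩ := by
  rw [grMul, grLift_grMk, LinearMap.flip_apply, grLift_grMk]
  rfl

instance : One (Gr k H) := ⟨grMk k 0 ⟨1, one_mem_coradFil⟩⟩

theorem gr_one_def : (1 : Gr k H) = grMk k 0 ⟨1, one_mem_coradFil⟩ := rfl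

theorem gr_one_mul (a : Gr k H) : grMul k H 1 a = a := by
  refine LinearMap.congr_fun (f := grMul k H 1) (g := LinearMap.id) (gr_hom_ext fun n x => ?_) a
  rw [gr_one_def, grMul_grMk]
  exact grMk_congr (zero_add n) (one_mul (x : H))

theorem gr_mul_one (a : Gr k H) : grMul k H a 1 = a := by
  refine LinearMap.congr_fun (f := (grMul k H).flip 1) (g := LinearMap.id)
    (gr_hom_ext fun n x => ?_) a
  rw [LinearMap.flip_apply, gr_one_def, grMul_grMk]
  exact grMk_congr (add_zero n) (mul_one (x : H))

theorem gr_mul_assoc (a b c : Gr k H) :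
    grMul k H (grMul k H a b) c = grMul k H a (grMul k H b c) := by
  have h : (grMul k H).compr₂ (grMul k H) =
      (LinearMap.llcomp k (Gr k H) (Gr k H) (Gr k H)).compl₁₂ (grMul k H) (grMul k H) := by
    refine gr_hom_ext fun m x => gr_hom_ext fun n y => gr_hom_ext fun l z => ?_
    change grMul k H (grMul k H (grMk k m x) (grMk k n y)) (grMk k l z) =
      grMul k H (grMk k m x) (grMul k H (grMk k n y) (grMk k l z))
    rw [grMul_grMk, grMul_grMk, grMul_grMk, grMul_grMk]
    exact grMk_congr (add_assoc m n l) (mul_assoc (x : H) y z)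
  exact LinearMap.congr_fun (LinearMap.congr_fun₂ h a b) c

/-- The algebra structure of `gr H`, with `(x + H_{m-1}) (y + H_{n-1}) = x y + H_{m+n-1}`. -/
instance : Ring (Gr k H) where
  __ := (inferInstance : AddCommGroup (Gr k H))
  mul a b := grMul k H a b
  left_distrib a b c := map_add (grMul k H a) b c
  right_distrib a b c := by
    change grMul k H (a + b) c = grMul k H a c + grMul k H b c
    rw [map_add, LinearMap.add_apply]
  zero_mul a := by
    change grMul k H 0 a = 0
    rw [map_zero, LinearMap.zero_apply]
  mul_zero a := map_zero (grMul k H a)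
  mul_assoc := gr_mul_assoc
  one_mul := gr_one_mul
  mul_one := gr_mul_one

theorem grMk_mul_grMk (m n : ℕ) (x : coradFil k H m) (y : coradFil k H n) :
    grMk k m x * grMk k n y = grMk k (m + n) ⟨(x : H) * (y : H), mul_mem_coradFil x.2 y.2⟩ :=
  grMul_grMk m n x y

instance : Algebra k (Gr k H) :=
  Algebra.ofModule
    (fun r a b => by
      change grMul k H (r • a) b = r • grMul k H a b
      rw [map_smul, LinearMap.smul_apply])
    (fun r a b => map_smul (grMul k H a) r b)

theorem gr_comul_mul (a b : Gr k H) :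
    Coalgebra.comul (R := k) (a * b) = Coalgebra.comul (R := k) a * Coalgebra.comul (R := k) b := by
  have h : (LinearMap.mul k (Gr k H)).compr₂ (Coalgebra.comul (R := k)) =
      (LinearMap.mul k (Gr k H ⊗[k] Gr k H)).compl₁₂ (Coalgebra.comul (R := k))
        (Coalgebra.comul (R := k)) := by
    refine gr_hom_ext fun m x => gr_hom_ext fun n y => ?_
    rw [LinearMap.compr₂_apply, LinearMap.compl₁₂_apply, LinearMap.mul_apply',
      LinearMap.mul_apply', grMk_mul_grMk, comul_grMk, comul_grMk, comul_grMk]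
    change grTensor k H (m + n) (Coalgebra.comul (R := k) ((x : H) * (y : H))) = _
    rw [Bialgebra.comul_mul]
    refine comul_mem_of_forall (P := LinearMap.eqLocus
      (grTensor k H (m + n) ∘ₗ LinearMap.mulRight k (Coalgebra.comul (R := k) (y : H)))
      (LinearMap.mulRight k (grTensor k H n (Coalgebra.comul (R := k) (y : H))) ∘ₗ
        grTensor k H m)) ?_ x.2
    intro i j hij u hu v hv
    refine comul_mem_of_forall (P := LinearMap.eqLocus
      (grTensor k H (m + n) ∘ₗ LinearMap.mulLeft k (u ⊗ₜ[k] v))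
      (LinearMap.mulLeft k (grTensor k H m (u ⊗ₜ[k] v)) ∘ₗ grTensor k H n)) ?_ y.2
    intro i' j' hij' u' hu' v' hv'
    simp only [LinearMap.mem_eqLocus, LinearMap.comp_apply, LinearMap.mulLeft_apply]
    rw [Algebra.TensorProduct.tmul_mul_tmul, grTensor_tmul hij hu hv, grTensor_tmul hij' hu' hv',
      Algebra.TensorProduct.tmul_mul_tmul, grMk_mul_grMk, grMk_mul_grMk,
      grTensor_tmul (by omega) (mul_mem_coradFil hu hu') (mul_mem_coradFil hv hv')]
  exact LinearMap.congr_fun₂ h a b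

theorem gr_counit_mul (a b : Gr k H) : Coalgebra.counit (R := k) (a * b) =
    Coalgebra.counit (R := k) a * Coalgebra.counit (R := k) b := by
  have h : (LinearMap.mul k (Gr k H)).compr₂ (Coalgebra.counit (R := k)) =
      (LinearMap.mul k k).compl₁₂ (Coalgebra.counit (R := k)) (Coalgebra.counit (R := k)) := by
    refine gr_hom_ext fun m x => gr_hom_ext fun n y => ?_
    rw [LinearMap.compr₂_apply, LinearMap.compl₁₂_apply, LinearMap.mul_apply',
      LinearMap.mul_apply', grMk_mul_grMk]
    change grCounit k H _ = grCounit k H _ * grCounit k H _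
    rcases Nat.eq_zero_or_pos m with rfl | hm
    · rcases Nat.eq_zero_or_pos n with rfl | hn
      · rw [grCounit_grMk_zero x, grCounit_grMk_zero y, ← Bialgebra.counit_mul]
        exact grCounit_grMk_zero (k := k) (C := H) _
      · rw [grCounit_grMk_of_pos hn, grCounit_grMk_of_pos (by omega), mul_zero]
    · rw [grCounit_grMk_of_pos hm, grCounit_grMk_of_pos (by omega), zero_mul]
  exact LinearMap.congr_fun₂ h a b

instance : Bialgebra k (Gr k H) :=
  Bialgebra.mk' k (Gr k H)
    (by
      rw [gr_one_def]
      exact (grCounit_grMk_zero _).trans Bialgebra.counit_one)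
    (gr_counit_mul _ _)
    (by
      rw [gr_one_def, comul_grMk]
      change grTensor k H 0 (Coalgebra.comul (R := k) (1 : H)) = _
      rw [Bialgebra.comul_one, Algebra.TensorProduct.one_def,
        grTensor_tmul rfl one_mem_coradFil one_mem_coradFil]
      rfl)
    (gr_comul_mul _ _)

variable (k H) in
/-- The antipode of `gr H`, induced by the antipode of `H`. -/
def grAntipode : Gr k H →ₗ[k] Gr k H :=
  grLift (fun n => grMk k n ∘ₗ
      (HopfAlgebra.antipode k (A := H)).restrict fun _ hx => antipode_mem_coradFil hx)
    fun _ _ hx => grMk_eq_zero (antipode_mem_coradFilPred hx)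

theorem grAntipode_grMk (n : ℕ) (x : coradFil k H n) :
    grAntipode k H (grMk k n x) =
      grMk k n ⟨HopfAlgebra.antipode k (x : H), antipode_mem_coradFil x.2⟩ := by
  rw [grAntipode, grLift_grMk]; rfl

theorem grExt_algebraMap_counit (n : ℕ) (x : coradFil k H n) :
    grExt k n (algebraMap k H (Coalgebra.counit (R := k) (x : H))) =
      algebraMap k (Gr k H) (Coalgebra.counit (R := k) (grMk k n x)) := by
  rw [Algebra.algebraMap_eq_smul_one, Algebra.algebraMap_eq_smul_one, map_smul]
  change _ = grCounit k H _ • _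
  rcases Nat.eq_zero_or_pos n with rfl | hn
  · rw [grCounit_grMk_zero, grExt_eq one_mem_coradFil, gr_one_def]
  · rw [grCounit_grMk_of_pos hn, grExt_eq_zero (mem_coradFilPred_of_lt hn one_mem_coradFil),
      smul_zero, zero_smul]

/-- The associated graded Hopf algebra of the coradical filtration. -/
instance : HopfAlgebra k (Gr k H) where
  antipode := grAntipode k H
  mul_antipode_rTensor_comul := by
    refine gr_hom_ext fun n x => ?_
    simp only [LinearMap.comp_apply]
    rw [comul_grMk, Algebra.linearMap_apply, ← grExt_algebraMap_counit,
      ← HopfAlgebra.mul_antipode_rTensor_comul_apply]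
    refine comul_mem_of_forall (P := LinearMap.eqLocus
      (LinearMap.mul' k (Gr k H) ∘ₗ (grAntipode k H).rTensor (Gr k H) ∘ₗ grTensor k H n)
      (grExt k n ∘ₗ LinearMap.mul' k H ∘ₗ (HopfAlgebra.antipode k (A := H)).rTensor H)) ?_ x.2
    intro i j hij u hu v hv
    subst hij
    simp only [LinearMap.mem_eqLocus, LinearMap.comp_apply]
    rw [grTensor_tmul rfl hu hv, LinearMap.rTensor_tmul, LinearMap.rTensor_tmul,
      LinearMap.mul'_apply, LinearMap.mul'_apply, grAntipode_grMk, grMk_mul_grMk,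
      grExt_eq (mul_mem_coradFil (antipode_mem_coradFil hu) hv)]
  mul_antipode_lTensor_comul := by
    refine gr_hom_ext fun n x => ?_
    simp only [LinearMap.comp_apply]
    rw [comul_grMk, Algebra.linearMap_apply, ← grExt_algebraMap_counit,
      ← HopfAlgebra.mul_antipode_lTensor_comul_apply]
    refine comul_mem_of_forall (P := LinearMap.eqLocus
      (LinearMap.mul' k (Gr k H) ∘ₗ (grAntipode k H).lTensor (Gr k H) ∘ₗ grTensor k H n)
      (grExt k n ∘ₗ LinearMap.mul' k H ∘ₗ (HopfAlgebra.antipode k (A := H)).lTensor H)) ?_ x.2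
    intro i j hij u hu v hv
    subst hij
    simp only [LinearMap.mem_eqLocus, LinearMap.comp_apply]
    rw [grTensor_tmul rfl hu hv, LinearMap.lTensor_tmul, LinearMap.lTensor_tmul,
      LinearMap.mul'_apply, LinearMap.mul'_apply, grAntipode_grMk, grMk_mul_grMk,
      grExt_eq (mul_mem_coradFil hu (antipode_mem_coradFil hv))]

variable (k H)

/-- The coradical as a subalgebra of `H`. -/
def coradicalSubalgebra : Subalgebra k H :=
  (coradical k H).toSubalgebra hH.isHopfSubalgebra.one_mem
    fun x y hx hy => hH.isHopfSubalgebra.mul_mem x hx y hy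

/-- The projection `π : gr H → H_0` onto the component of degree zero, as a linear map. -/
def grProjLin : Gr k H →ₗ[k] coradicalSubalgebra k H :=
  grLift (fun n => match n with
    | 0 => (LinearMap.id : coradicalSubalgebra k H →ₗ[k] coradicalSubalgebra k H)
    | _ + 1 => 0) fun n x hx => by
      cases n with
      | zero => exact Subtype.ext hx
      | succ n => rfl

variable {k H} in
theorem grProjLin_grMk_zero (x : coradFil k H 0) : grProjLin k H (grMk k 0 x) = ⟨x, x.2⟩ := by
  rw [grProjLin, grLift_grMk]; rfl

variable {k H} in
theorem grProjLin_grMk_of_pos {n : ℕ} (hn : 0 < n) (x : coradFil k H n) :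
    grProjLin k H (grMk k n x) = 0 := by
  obtain ⟨n, rfl⟩ := Nat.exists_eq_succ_of_ne_zero hn.ne'
  rw [grProjLin, grLift_grMk]; rfl

variable {k H} in
theorem grProjLin_mul (a b : Gr k H) :
    grProjLin k H (a * b) = grProjLin k H a * grProjLin k H b := by
  have h : (LinearMap.mul k (Gr k H)).compr₂ (grProjLin k H) =
      (LinearMap.mul k (coradicalSubalgebra k H)).compl₁₂ (grProjLin k H) (grProjLin k H) := by
    refine gr_hom_ext fun m x => gr_hom_ext fun n y => ?_
    rw [LinearMap.compr₂_apply, LinearMap.compl₁₂_apply, LinearMap.mul_apply',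
      LinearMap.mul_apply', grMk_mul_grMk]
    rcases Nat.eq_zero_or_pos m with rfl | hm
    · rcases Nat.eq_zero_or_pos n with rfl | hn
      · rw [grProjLin_grMk_zero x, grProjLin_grMk_zero y]
        exact grProjLin_grMk_zero (k := k) (H := H) _
      · rw [grProjLin_grMk_of_pos hn, grProjLin_grMk_of_pos (by omega), mul_zero]
    · rw [grProjLin_grMk_of_pos hm, grProjLin_grMk_of_pos (by omega), zero_mul]
  exact LinearMap.congr_fun₂ h a b

/-- The projection `π : gr H → H_0` onto the component of degree zero. -/
def grProj : Gr k H →ₐ[k] coradicalSubalgebra k H :=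
  AlgHom.ofLinearMap (grProjLin k H) (grProjLin_grMk_zero (k := k) (H := H) _) grProjLin_mul

/-- The diagram of `H`: the subalgebra `R = {a ∈ gr H | (id ⊗ π) Δ(a) = a ⊗ 1}` of coinvariants of
`gr H` with respect to the coaction `(id ⊗ π) Δ` of `H_0`. -/
def diagram : Subalgebra k (Gr k H) :=
  AlgHom.equalizer
    ((Algebra.TensorProduct.map (AlgHom.id k (Gr k H)) (grProj k H)).comp
      (Bialgebra.comulAlgHom k (Gr k H)))
    (Algebra.TensorProduct.includeLeft : Gr k H →ₐ[k] Gr k H ⊗[k] coradicalSubalgebra k H)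

end Filtration

end HopfAlgebras

end

end CoradFilt

/-! The proof plays integrals off against filtrations. The coradical of every Hopf algebra is `k 1 ⊕
E` with `E` a subcoalgebra, so a functional `t` with `t 1 = 1` that vanishes on `E` restricts to a
two-sided integral there. If `K` is a Hopf subalgebra with such a `t`, the form `t(x y)` on `K` has
trivial left and right radicals (`IsHaar.eq_zero_of_mul_left`, `IsHaar.eq_zero_of_mul_right`).

Let `F` be an exhaustive Hopf filtration with `F 0 = 0` and lowest layer in `K`. A left integral `T`
satisfies `y₁ T(x y₂) = S(x₁) T(x₂ y)`, so for `x` in `F n` the left side stays in `F n`, whatever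
`y` is. If `ξ` kills `F m`, `m ≥ n`, and `y` is in `F (m+1)`, then `ξ(y₁) y₂` lies in `K`; a
suitable `x` makes it orthogonal to `K`, so it is zero and `ξ(y) = 0`. Hence `F` stops at `n`
(`IsHopfFiltration.exists_eq_top`). Conversely, if `F m ≠ F (m+1) = H`, a nonzero `f` that kills `F
m` gives a colinear map `g(h) = h₁ f(h₂)` from `H` to `K`. The composite of `t` with `g` has the
integral property but may vanish; so may each twist `t(g(h S(c₁)) c₂)`, but if all of them vanish,
then `t(g(h) c) = 0` for all `c` in `K`, which forces `g = 0` and `f = 0`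
(`IsHopfFiltration.isCoFrobenius`).

For the coradical filtration of `H`, exhaustive by `exists_mem_coradFilPred`, this is the
equivalence of 1 and 4. For the degree filtration of `gr H`, with `K` the degree zero part, it says
that `gr H` is co-Frobenius exactly when its degrees are bounded, which is again 4; the coradical of
`gr H` need not be identified.

For the diagram `R`, a left integral on `gr H` with `T(h) ≠ 0` gives the map `y ↦ y₁ T(h y₂)`, of
finite rank by the identity above. On `R` its leading term is `T(h) y`, so it is injective there and
`R` is finite-dimensional. In the other direction `gr H = R H₀` (`mem_of_forall_diagram_mul_mem`),
so a finite-dimensional `R` bounds the degrees. -/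

namespace CoradFilt

noncomputable section

/-! ### Slices of tensors by functionals -/

section Contraction

variable {k : Type*} [Field k] {V W V' W' : Type*} [AddCommGroup V] [Module k V]
  [AddCommGroup W] [Module k W] [AddCommGroup V'] [Module k V'] [AddCommGroup W'] [Module k W']

/-- The map `v ⊗ w ↦ ξ v • w`. -/
def contractLeft (ξ : V →ₗ[k] k) : V ⊗[k] W →ₗ[k] W :=
  (TensorProduct.lid k W).toLinearMap ∘ₗ ξ.rTensor W

/-- The map `v ⊗ w ↦ ξ w • v`. -/
def contractRight (ξ : W →ₗ[k] k) : V ⊗[k] W →ₗ[k] V :=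
  (TensorProduct.rid k V).toLinearMap ∘ₗ ξ.lTensor V

@[simp]
theorem contractLeft_tmul (ξ : V →ₗ[k] k) (v : V) (w : W) :
    contractLeft ξ (v ⊗ₜ[k] w) = ξ v • w := by
  simp [contractLeft]

@[simp]
theorem contractRight_tmul (ξ : W →ₗ[k] k) (v : V) (w : W) :
    contractRight ξ (v ⊗ₜ[k] w) = ξ w • v := by
  simp [contractRight]

theorem contractLeft_map (f : V →ₗ[k] V') (g : W →ₗ[k] W') (ξ : V' →ₗ[k] k) (s : V ⊗[k] W) :
    contractLeft ξ (TensorProduct.map f g s) = g (contractLeft (ξ ∘ₗ f) s) := by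
  refine LinearMap.congr_fun (f := contractLeft ξ ∘ₗ TensorProduct.map f g)
    (g := g ∘ₗ contractLeft (ξ ∘ₗ f)) ?_ s
  ext v w
  simp

theorem contractRight_map (f : V →ₗ[k] V') (g : W →ₗ[k] W') (ξ : W' →ₗ[k] k) (s : V ⊗[k] W) :
    contractRight ξ (TensorProduct.map f g s) = f (contractRight (ξ ∘ₗ g) s) := by
  refine LinearMap.congr_fun (f := contractRight ξ ∘ₗ TensorProduct.map f g)
    (g := f ∘ₗ contractRight (ξ ∘ₗ g)) ?_ s
  ext v w
  simp

theorem apply_contractLeft (ξ : V →ₗ[k] k) (η : W →ₗ[k] k) (s : V ⊗[k] W) :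
    η (contractLeft ξ s) = ξ (contractRight η s) := by
  refine LinearMap.congr_fun (f := η ∘ₗ contractLeft ξ) (g := ξ ∘ₗ contractRight η) ?_ s
  ext v w
  simp [mul_comm]

/-- Functionals separate the points of a vector space. -/
theorem eq_of_forall_functional_eq {v w : V} (h : ∀ ξ : V →ₗ[k] k, ξ v = ξ w) : v = w := by
  rw [← sub_eq_zero, ← Module.forall_dual_apply_eq_zero_iff k]
  intro ξ
  rw [map_sub, h, sub_self]

/-- The coordinate functionals of a basis of `V` already suffice: they read off the coefficients of
`s` in `W`. -/
theorem eq_zero_of_forall_contractLeft {s : V ⊗[k] W}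
    (h : ∀ ξ : V →ₗ[k] k, contractLeft ξ s = 0) : s = 0 := by
  classical
  let b := Module.Basis.ofVectorSpace k V
  apply (TensorProduct.equivFinsuppOfBasisLeft (N := W) b).injective
  rw [map_zero]
  ext i
  have e : Finsupp.lapply i ∘ₗ (TensorProduct.equivFinsuppOfBasisLeft (N := W) b).toLinearMap =
      contractLeft (b.coord i) := by
    ext v w
    simp
  exact (LinearMap.congr_fun e s).trans (h _)

theorem eq_zero_of_forall_contractRight {s : V ⊗[k] W}
    (h : ∀ ξ : W →ₗ[k] k, contractRight ξ s = 0) : s = 0 := by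
  refine eq_zero_of_forall_contractLeft fun ξ => eq_of_forall_functional_eq (k := k) fun η => ?_
  rw [apply_contractLeft, h, map_zero, map_zero]

end Contraction

/-! ### Membership in `V ⊗ W` tested on slices -/

section Subspaces

variable {k : Type*} [Field k] {C : Type*} [AddCommGroup C] [Module k C]

theorem tensorSub_top_top : tensorSub k (⊤ : Submodule k C) ⊤ = ⊤ := by
  rw [eq_top_iff, ← TensorProduct.span_tmul_eq_top, Submodule.span_le]
  rintro _ ⟨v, w, rfl⟩
  exact tmul_mem_tensorSub trivial trivial

theorem tensorSub_bot_left (W : Submodule k C) : tensorSub k ⊥ W = ⊥ := by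
  rw [eq_bot_iff]
  refine tensorSub_le fun v hv w _ => ?_
  rw [(Submodule.mem_bot k).1 hv, TensorProduct.zero_tmul]
  exact Submodule.zero_mem _

theorem tensorSub_bot_right (V : Submodule k C) : tensorSub k V ⊥ = ⊥ := by
  rw [eq_bot_iff]
  refine tensorSub_le fun v _ w hw => ?_
  rw [(Submodule.mem_bot k).1 hw, TensorProduct.tmul_zero]
  exact Submodule.zero_mem _

theorem contractLeft_mem {V W : Submodule k C} {s : C ⊗[k] C} (hs : s ∈ tensorSub k V W)
    (ξ : C →ₗ[k] k) : contractLeft ξ s ∈ W := by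
  refine (tensorSub_le fun v _ w hw => ?_ : _ ≤ W.comap (contractLeft ξ)) hs
  rw [Submodule.mem_comap, contractLeft_tmul]
  exact W.smul_mem _ hw

theorem contractRight_mem {V W : Submodule k C} {s : C ⊗[k] C} (hs : s ∈ tensorSub k V W)
    (ξ : C →ₗ[k] k) : contractRight ξ s ∈ V := by
  refine (tensorSub_le fun v hv w _ => ?_ : _ ≤ V.comap (contractRight ξ)) hs
  rw [Submodule.mem_comap, contractRight_tmul]
  exact V.smul_mem _ hv

theorem mem_tensorSub_top_right {V : Submodule k C} {s : C ⊗[k] C}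
    (h : ∀ ξ : C →ₗ[k] k, contractRight ξ s ∈ V) : s ∈ tensorSub k V ⊤ := by
  have h1 := mem_sup_of_map_mkQ_eq_zero (U := ⊤) (V := V) (W := ⊥) (t := s)
    (tensorSub_top_top (k := k) (C := C) ▸ trivial) (eq_zero_of_forall_contractRight fun ξ => by
      rw [contractRight_map]
      exact (Submodule.Quotient.mk_eq_zero _).2 (h _))
  rwa [tensorSub_bot_right, sup_bot_eq] at h1

/-- The right slices place `s` in `V ⊗ C`; the left slices then show that `s` dies in `C ⊗ C/W`.
This turns statements about comultiplications into statements about functionals. -/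
theorem mem_tensorSub_of_forall {V W : Submodule k C} {s : C ⊗[k] C}
    (hl : ∀ ξ : C →ₗ[k] k, contractLeft ξ s ∈ W) (hr : ∀ ξ : C →ₗ[k] k, contractRight ξ s ∈ V) :
    s ∈ tensorSub k V W := by
  have h1 := mem_sup_of_map_mkQ_eq_zero (U := V) (V := ⊥) (W := W) (t := s)
    (mem_tensorSub_top_right hr) (eq_zero_of_forall_contractLeft fun ξ => by
      rw [contractLeft_map]
      exact (Submodule.Quotient.mk_eq_zero _).2 (hl _))
  rwa [tensorSub_bot_left, bot_sup_eq] at h1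

end Subspaces

/-! ### The two actions of functionals on a coalgebra -/

section Hits

variable {k : Type*} [Field k] {C : Type*} [AddCommGroup C] [Module k C] [Coalgebra k C]

/-- The map `c ↦ ξ(c₁) c₂`. -/
def hitLeft (ξ : C →ₗ[k] k) : C →ₗ[k] C := contractLeft ξ ∘ₗ Coalgebra.comul

/-- The map `c ↦ c₁ ξ(c₂)`. -/
def hitRight (ξ : C →ₗ[k] k) : C →ₗ[k] C := contractRight ξ ∘ₗ Coalgebra.comul

theorem hitLeft_apply (ξ : C →ₗ[k] k) (c : C) :
    hitLeft ξ c = contractLeft ξ (Coalgebra.comul (R := k) c) := rfl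

theorem hitRight_apply (ξ : C →ₗ[k] k) (c : C) :
    hitRight ξ c = contractRight ξ (Coalgebra.comul (R := k) c) := rfl

theorem apply_hitLeft (ξ η : C →ₗ[k] k) (c : C) : η (hitLeft ξ c) = ξ (hitRight η c) :=
  apply_contractLeft ξ η _

theorem hitLeft_counit (c : C) : hitLeft (Coalgebra.counit (R := k)) c = c := by
  simp [hitLeft, contractLeft]

theorem hitRight_counit (c : C) : hitRight (Coalgebra.counit (R := k)) c = c := by
  simp [hitRight, contractRight]

theorem counit_hitLeft (ξ : C →ₗ[k] k) (c : C) :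
    Coalgebra.counit (R := k) (hitLeft ξ c) = ξ c := by
  rw [apply_hitLeft, hitRight_counit]

theorem counit_hitRight (ξ : C →ₗ[k] k) (c : C) :
    Coalgebra.counit (R := k) (hitRight ξ c) = ξ c := by
  rw [← apply_hitLeft, hitLeft_counit]

/-- Coassociativity, read as colinearity: `c ↦ c₁ ξ(c₂)` commutes with the left coaction of `C` on
itself. -/
theorem comul_hitRight (ξ : C →ₗ[k] k) (c : C) : Coalgebra.comul (R := k) (hitRight ξ c) =
    (hitRight ξ).lTensor C (Coalgebra.comul (R := k) c) := by
  have e1 : (Coalgebra.comul (R := k) (A := C)) ∘ₗ contractRight ξ =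
      contractRight ξ ∘ₗ (Coalgebra.comul (R := k) (A := C)).rTensor C := by
    ext; simp
  have e2 : contractRight (V := C ⊗[k] C) ξ =
      (contractRight ξ).lTensor C ∘ₗ (TensorProduct.assoc k C C C).toLinearMap := by
    ext; simp
  have h1 := LinearMap.congr_fun e1 (Coalgebra.comul (R := k) c)
  simp only [LinearMap.comp_apply] at h1
  rw [hitRight_apply, h1, e2, LinearMap.comp_apply, LinearEquiv.coe_coe, Coalgebra.coassoc_apply,
    ← LinearMap.comp_apply, ← LinearMap.lTensor_comp]
  rfl

theorem comul_hitLeft (ξ : C →ₗ[k] k) (c : C) : Coalgebra.comul (R := k) (hitLeft ξ c) =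
    (hitLeft ξ).rTensor C (Coalgebra.comul (R := k) c) := by
  have e1 : (Coalgebra.comul (R := k) (A := C)) ∘ₗ contractLeft ξ =
      contractLeft ξ ∘ₗ (Coalgebra.comul (R := k) (A := C)).lTensor C := by
    ext; simp
  have e2 : contractLeft (W := C ⊗[k] C) ξ =
      (contractLeft ξ).rTensor C ∘ₗ (TensorProduct.assoc k C C C).symm.toLinearMap := by
    ext; simp [TensorProduct.smul_tmul']
  have h1 := LinearMap.congr_fun e1 (Coalgebra.comul (R := k) c)
  simp only [LinearMap.comp_apply] at h1
  rw [hitLeft_apply, h1, e2, LinearMap.comp_apply, LinearEquiv.coe_coe,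
    Coalgebra.coassoc_symm_apply, ← LinearMap.comp_apply, ← LinearMap.rTensor_comp]
  rfl

theorem hitRight_hitRight (ξ η : C →ₗ[k] k) (c : C) :
    hitRight ξ (hitRight η c) = hitRight (ξ ∘ₗ hitRight η) c := by
  rw [hitRight_apply, comul_hitRight, LinearMap.lTensor, contractRight_map]
  rfl

theorem hitLeft_hitLeft (ξ η : C →ₗ[k] k) (c : C) :
    hitLeft ξ (hitLeft η c) = hitLeft (ξ ∘ₗ hitLeft η) c := by
  rw [hitLeft_apply, comul_hitLeft, LinearMap.rTensor, contractLeft_map]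
  rfl

theorem hitLeft_hitRight (ξ η : C →ₗ[k] k) (c : C) :
    hitLeft ξ (hitRight η c) = hitRight η (hitLeft ξ c) := by
  rw [hitLeft_apply, comul_hitRight, LinearMap.lTensor, contractLeft_map]
  rfl

/-- Subcoalgebras are the subspaces stable under both actions of the dual, which makes intersections
tractable. -/
theorem isSubcoalgebra_iff {D : Submodule k C} : IsSubcoalgebra k D ↔
    (∀ (ξ : C →ₗ[k] k), ∀ d ∈ D, hitLeft ξ d ∈ D) ∧
      ∀ (ξ : C →ₗ[k] k), ∀ d ∈ D, hitRight ξ d ∈ D :=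
  ⟨fun h => ⟨fun ξ d hd => contractLeft_mem (h d hd) ξ, fun ξ d hd => contractRight_mem (h d hd) ξ⟩,
    fun h d hd => mem_tensorSub_of_forall (fun ξ => h.1 ξ d hd) fun ξ => h.2 ξ d hd⟩

theorem IsSubcoalgebra.hitLeft_mem {D : Submodule k C} (h : IsSubcoalgebra k D) (ξ : C →ₗ[k] k)
    {d : C} (hd : d ∈ D) : hitLeft ξ d ∈ D := (isSubcoalgebra_iff.1 h).1 ξ d hd

theorem IsSubcoalgebra.hitRight_mem {D : Submodule k C} (h : IsSubcoalgebra k D) (ξ : C →ₗ[k] k)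
    {d : C} (hd : d ∈ D) : hitRight ξ d ∈ D := (isSubcoalgebra_iff.1 h).2 ξ d hd

theorem IsSubcoalgebra.inf {D E : Submodule k C} (hD : IsSubcoalgebra k D)
    (hE : IsSubcoalgebra k E) : IsSubcoalgebra k (D ⊓ E) :=
  isSubcoalgebra_iff.2 ⟨fun ξ _ hd => ⟨hD.hitLeft_mem ξ hd.1, hE.hitLeft_mem ξ hd.2⟩,
    fun ξ _ hd => ⟨hD.hitRight_mem ξ hd.1, hE.hitRight_mem ξ hd.2⟩⟩

theorem isSubcoalgebra_sSup {s : Set (Submodule k C)} (h : ∀ D ∈ s, IsSubcoalgebra k D) :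
    IsSubcoalgebra k (sSup s) := fun _ hd =>
  (sSup_le fun D hD x hx => tensorSub_mono (le_sSup hD) (le_sSup hD) (h D hD x hx) :
    sSup s ≤ (tensorSub k (sSup s) (sSup s)).comap Coalgebra.comul) hd

theorem IsSubcoalgebra.sup {D E : Submodule k C} (hD : IsSubcoalgebra k D)
    (hE : IsSubcoalgebra k E) : IsSubcoalgebra k (D ⊔ E) := by
  rw [← sSup_pair]
  refine isSubcoalgebra_sSup fun X hX => ?_
  rcases hX with rfl | hX
  · exact hD
  · rw [Set.mem_singleton_iff.1 hX]; exact hE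

/-- A nonzero finite-dimensional subcoalgebra contains a simple subcoalgebra. -/
theorem exists_isSimpleSubcoalgebra_le {D : Submodule k C} (hD : IsSubcoalgebra k D) (h0 : D ≠ ⊥)
    [FiniteDimensional k D] : ∃ E ≤ D, IsSimpleSubcoalgebra k E := by
  induction hn : Module.finrank k D using Nat.strong_induction_on generalizing D with
  | _ n ih =>
    -- Either `D` is simple itself, or a proper nonzero subcoalgebra has smaller dimension.
    by_cases hs : ∀ E : Submodule k C, IsSubcoalgebra k E → E ≤ D → E = ⊥ ∨ E = D
    · exact ⟨D, le_rfl, hD, h0, hs⟩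
    · push Not at hs
      obtain ⟨E, hE, hED, hE0, hne⟩ := hs
      have hlt := lt_of_le_of_ne hED hne
      have : FiniteDimensional k E := Submodule.finiteDimensional_of_le hED
      obtain ⟨F, hF, hFs⟩ := ih _ (hn ▸ Submodule.finrank_lt_finrank_of_lt hlt) hE hE0 rfl
      exact ⟨F, hF.trans hED, hFs⟩

end Hits

/-! ### Integrals and the antipode -/

section Integrals

variable {k : Type*} [Field k] {H : Type*} [Ring H] [HopfAlgebra k H]

/-- Testing `h₁ T(h₂) = T(h) 1` against all functionals `α` gives the convolution identity `α T =
α(1) T`. -/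
theorem isCoFrobenius_iff :
    IsCoFrobenius k H ↔ ∃ T : H →ₗ[k] k, T ≠ 0 ∧ ∀ h, hitRight T h = T h • 1 := by
  have key : ∀ (T α : H →ₗ[k] k) (h : H),
      (LinearMap.mul' k k ∘ₗ TensorProduct.map α T ∘ₗ Coalgebra.comul) h = α (hitRight T h) := by
    intro T α h
    have e : LinearMap.mul' k k ∘ₗ TensorProduct.map α T = α ∘ₗ contractRight T := by
      ext x y
      simp [mul_comm]
    exact LinearMap.congr_fun e (Coalgebra.comul (R := k) h)
  refine exists_congr fun T => and_congr_right fun _ => ⟨fun hT h => ?_, fun hT α => ?_⟩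
  · refine eq_of_forall_functional_eq (k := k) fun α => ?_
    rw [← key, hT]
    simp [mul_comm]
  · ext h
    rw [key, hT]
    simp [mul_comm]

/-- If `T` is a left integral on a right coideal that contains `K y`, with `K` a subcoalgebra, then
`y₁ T(x y₂) = S(x₁) T(x₂ y)` for `x` in `K`. -/
theorem hitRight_mulLeft {K : Submodule k H} (hK : IsSubcoalgebra k K) {T : H →ₗ[k] k} {y : H}
    (hT : ∀ x ∈ K, hitRight T (x * y) = T (x * y) • 1) {x : H} (hx : x ∈ K) :
    hitRight (T ∘ₗ LinearMap.mulLeft k x) y =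
      HopfAlgebra.antipode k (hitRight (T ∘ₗ LinearMap.mulRight k y) x) := by
  -- `P x = y₁ T(x y₂)`
  let P : H →ₗ[k] H :=
    contractRight T ∘ₗ LinearMap.mulRight k (Coalgebra.comul (R := k) y) ∘ₗ TensorProduct.mk k H H 1
  have hP : ∀ x, P x = hitRight (T ∘ₗ LinearMap.mulLeft k x) y := by
    intro x
    have e : contractRight T ∘ₗ LinearMap.mulLeft k ((1 : H) ⊗ₜ[k] x) =
        contractRight (T ∘ₗ LinearMap.mulLeft k x) := by
      ext a b
      simp
    exact LinearMap.congr_fun e (Coalgebra.comul (R := k) y)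
  -- In convolution terms, `id * P` is `x ↦ (x y)₁ T((x y)₂)`.
  have hG : ∀ x, hitRight T (x * y) =
      LinearMap.mul' k H (P.lTensor H (Coalgebra.comul (R := k) x)) := by
    intro x
    have e : contractRight T ∘ₗ LinearMap.mulRight k (Coalgebra.comul (R := k) y) =
        LinearMap.mul' k H ∘ₗ P.lTensor H := by
      ext a b
      have e' : contractRight T ∘ₗ LinearMap.mulLeft k (a ⊗ₜ[k] b) =
          LinearMap.mulLeft k a ∘ₗ contractRight T ∘ₗ LinearMap.mulLeft k ((1 : H) ⊗ₜ[k] b) := by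
        ext c d
        simp
      exact LinearMap.congr_fun e' (Coalgebra.comul (R := k) y)
    rw [hitRight_apply, Bialgebra.comul_mul]
    exact LinearMap.congr_fun e (Coalgebra.comul (R := k) x)
  -- Since `S` is the convolution inverse of the identity, `P = S * (id * P)`. On `K` the inner
  -- factor is `x ↦ T(x y) 1` by the integral property, which leaves `S(x₁) T(x₂ y)`.
  have hconv : WithConv.toConv (HopfAlgebra.antipode k (A := H)) *
      (WithConv.toConv LinearMap.id * WithConv.toConv P) = WithConv.toConv P := by
    rw [← mul_assoc, LinearMap.antipode_mul_id, one_mul]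
  have h1 := LinearMap.congr_fun (congrArg WithConv.ofConv hconv) x
  rw [← hP]
  refine h1.symm.trans ?_
  change LinearMap.mul' k H (TensorProduct.map (HopfAlgebra.antipode k)
    (LinearMap.mul' k H ∘ₗ P.lTensor H ∘ₗ Coalgebra.comul) (Coalgebra.comul (R := k) x)) = _
  refine (tensorSub_le fun u _ v hv => ?_ : _ ≤ LinearMap.eqLocus
    (LinearMap.mul' k H ∘ₗ TensorProduct.map (HopfAlgebra.antipode k)
      (LinearMap.mul' k H ∘ₗ P.lTensor H ∘ₗ Coalgebra.comul))
    (HopfAlgebra.antipode k ∘ₗ contractRight (T ∘ₗ LinearMap.mulRight k y))) (hK x hx)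
  simp only [LinearMap.mem_eqLocus, LinearMap.comp_apply, TensorProduct.map_tmul,
    LinearMap.mul'_apply, contractRight_tmul, map_smul]
  rw [← hG, hT v hv]
  simp

/-- If `T` is a right integral on a left coideal that contains `x K`, with `K` a subcoalgebra, then
`T(x₁ y) x₂ = T(x y₁) S(y₂)` for `y` in `K`. -/
theorem hitLeft_mulRight {K : Submodule k H} (hK : IsSubcoalgebra k K) {T : H →ₗ[k] k} {x : H}
    (hT : ∀ y ∈ K, hitLeft T (x * y) = T (x * y) • 1) {y : H} (hy : y ∈ K) :
    hitLeft (T ∘ₗ LinearMap.mulRight k y) x =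
      HopfAlgebra.antipode k (hitLeft (T ∘ₗ LinearMap.mulLeft k x) y) := by
  -- `P y = T(x₁ y) x₂`
  let P : H →ₗ[k] H :=
    contractLeft T ∘ₗ LinearMap.mulLeft k (Coalgebra.comul (R := k) x) ∘ₗ
      (TensorProduct.mk k H H).flip 1
  have hP : ∀ y, P y = hitLeft (T ∘ₗ LinearMap.mulRight k y) x := by
    intro y
    have e : contractLeft T ∘ₗ LinearMap.mulRight k (y ⊗ₜ[k] (1 : H)) =
        contractLeft (T ∘ₗ LinearMap.mulRight k y) := by
      ext a b
      simp
    exact LinearMap.congr_fun e (Coalgebra.comul (R := k) x)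
  have hG : ∀ y, hitLeft T (x * y) =
      LinearMap.mul' k H (P.rTensor H (Coalgebra.comul (R := k) y)) := by
    intro y
    have e : contractLeft T ∘ₗ LinearMap.mulLeft k (Coalgebra.comul (R := k) x) =
        LinearMap.mul' k H ∘ₗ P.rTensor H := by
      ext a b
      have e' : contractLeft T ∘ₗ LinearMap.mulRight k (a ⊗ₜ[k] b) =
          LinearMap.mulRight k b ∘ₗ contractLeft T ∘ₗ
            LinearMap.mulRight k (a ⊗ₜ[k] (1 : H)) := by
        ext c d
        simp
      exact LinearMap.congr_fun e' (Coalgebra.comul (R := k) x)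
    rw [hitLeft_apply, Bialgebra.comul_mul]
    exact LinearMap.congr_fun e (Coalgebra.comul (R := k) y)
  -- The mirror image: `P = (P * id) * S`, and on `K` the inner factor is the scalar `T(x y)`.
  have hconv : WithConv.toConv P * WithConv.toConv LinearMap.id *
      WithConv.toConv (HopfAlgebra.antipode k (A := H)) = WithConv.toConv P := by
    rw [mul_assoc, LinearMap.id_mul_antipode, mul_one]
  have h1 := LinearMap.congr_fun (congrArg WithConv.ofConv hconv) y
  rw [← hP]
  refine h1.symm.trans ?_
  change LinearMap.mul' k H (TensorProduct.map
    (LinearMap.mul' k H ∘ₗ P.rTensor H ∘ₗ Coalgebra.comul) (HopfAlgebra.antipode k)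
      (Coalgebra.comul (R := k) y)) = _
  refine (tensorSub_le fun u hu v _ => ?_ : _ ≤ LinearMap.eqLocus
    (LinearMap.mul' k H ∘ₗ TensorProduct.map
      (LinearMap.mul' k H ∘ₗ P.rTensor H ∘ₗ Coalgebra.comul) (HopfAlgebra.antipode k))
    (HopfAlgebra.antipode k ∘ₗ contractLeft (T ∘ₗ LinearMap.mulLeft k x))) (hK y hy)
  simp only [LinearMap.mem_eqLocus, LinearMap.comp_apply, TensorProduct.map_tmul,
    LinearMap.mul'_apply, contractLeft_tmul, map_smul]
  rw [← hG, hT u hu]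
  simp

/-! ### Normalized integrals and nondegeneracy of their forms -/

/-- A functional on `H` that restricts to a normalized two-sided integral on `K`. -/
structure IsHaar (K : Submodule k H) (t : H →ₗ[k] k) : Prop where
  map_one : t 1 = 1
  left : ∀ x ∈ K, hitRight t x = t x • 1
  right : ∀ x ∈ K, hitLeft t x = t x • 1

/-- The radical `J` of the form is a left ideal of `K`, and the exchange formula `hitRight_mulLeft`
gives `Δ(J) ⊆ K ⊗ J`. So `ε(y) 1 = S(y₁) y₂` lies in `J` for `y` in `J`, and `t 1 = 1` forces `ε(y)
= 0`. Then `y = y₁ ε(y₂) = 0`. -/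
theorem IsHaar.eq_zero_of_mul_left {K : Submodule k H} (hK : IsHopfSubalgebra k K) {t : H →ₗ[k] k}
    (ht : IsHaar K t) {y : H} (hy : y ∈ K) (h : ∀ c ∈ K, t (c * y) = 0) : y = 0 := by
  let J : Submodule k H :=
    { carrier := {y | y ∈ K ∧ ∀ c ∈ K, t (c * y) = 0}
      zero_mem' := ⟨K.zero_mem, fun c _ => by simp⟩
      add_mem' := fun {a b} ha hb => ⟨K.add_mem ha.1 hb.1, fun c hc => by
        rw [mul_add, map_add, ha.2 c hc, hb.2 c hc, add_zero]⟩
      smul_mem' := fun r a ha => ⟨K.smul_mem r ha.1, fun c hc => by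
        rw [mul_smul_comm, map_smul, ha.2 c hc, smul_zero]⟩ }
  have hJ : ∀ y ∈ J, ∀ c ∈ K, c * y ∈ J := fun y hy c hc =>
    ⟨hK.mul_mem c hc y hy.1, fun d hd => by
      rw [← mul_assoc]; exact hy.2 _ (hK.mul_mem d hd c hc)⟩
  have hΔ : ∀ y ∈ J, Coalgebra.comul (R := k) y ∈ tensorSub k K J := fun y hy => by
    refine mem_tensorSub_of_forall (fun ξ => ⟨hK.isSubcoalgebra.hitLeft_mem ξ hy.1, fun c hc => ?_⟩)
      fun ξ => hK.isSubcoalgebra.hitRight_mem ξ hy.1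
    -- `t(c ξ(y₁) y₂) = ξ(y₁ t(c y₂)) = ξ(S(c₁)) t(c₂ y)`, which is zero because `c₂` stays in `K`
    -- and `y` is in the radical.
    have h1 := hitRight_mulLeft hK.isSubcoalgebra (T := t) (y := y)
      (fun x hx => ht.left _ (hK.mul_mem x hx y hy.1)) hc
    have h2 : hitRight (t ∘ₗ LinearMap.mulRight k y) c = 0 := by
      refine (tensorSub_le fun u _ v hv => ?_ : _ ≤ LinearMap.ker (contractRight _))
        (hK.isSubcoalgebra c hc)
      rw [LinearMap.mem_ker, contractRight_tmul, LinearMap.comp_apply, LinearMap.mulRight_apply,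
        hy.2 v hv, zero_smul]
    rw [h2, map_zero] at h1
    have h3 := apply_hitLeft ξ (t ∘ₗ LinearMap.mulLeft k c) y
    rw [h1, map_zero] at h3
    exact h3
  have hε : ∀ y ∈ J, Coalgebra.counit (R := k) y = 0 := fun y hy => by
    have h1 : LinearMap.mul' k H ((HopfAlgebra.antipode k).rTensor H
        (Coalgebra.comul (R := k) y)) ∈ J := by
      refine (tensorSub_le fun u hu v hv => ?_ : _ ≤ J.comap
        (LinearMap.mul' k H ∘ₗ (HopfAlgebra.antipode k).rTensor H)) (hΔ y hy)
      exact hJ v hv _ (hK.antipode_mem u hu)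
    rw [HopfAlgebra.mul_antipode_rTensor_comul_apply] at h1
    have h2 := h1.2 1 hK.one_mem
    rwa [one_mul, Algebra.algebraMap_eq_smul_one, map_smul, ht.map_one, smul_eq_mul,
      mul_one] at h2
  have hyJ : y ∈ J := ⟨hy, h⟩
  rw [← hitRight_counit (k := k) y]
  refine (tensorSub_le fun u _ v hv => ?_ : _ ≤ LinearMap.ker (contractRight _)) (hΔ y hyJ)
  rw [LinearMap.mem_ker, contractRight_tmul, hε v hv, zero_smul]

/-- The mirror argument: the radical `J` is a right ideal of `K` with `Δ(J) ⊆ J ⊗ K`, and one uses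
`y₁ S(y₂) = ε(y) 1`. -/
theorem IsHaar.eq_zero_of_mul_right {K : Submodule k H} (hK : IsHopfSubalgebra k K) {t : H →ₗ[k] k}
    (ht : IsHaar K t) {y : H} (hy : y ∈ K) (h : ∀ c ∈ K, t (y * c) = 0) : y = 0 := by
  let J : Submodule k H :=
    { carrier := {y | y ∈ K ∧ ∀ c ∈ K, t (y * c) = 0}
      zero_mem' := ⟨K.zero_mem, fun c _ => by simp⟩
      add_mem' := fun {a b} ha hb => ⟨K.add_mem ha.1 hb.1, fun c hc => by
        rw [add_mul, map_add, ha.2 c hc, hb.2 c hc, add_zero]⟩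
      smul_mem' := fun r a ha => ⟨K.smul_mem r ha.1, fun c hc => by
        rw [smul_mul_assoc, map_smul, ha.2 c hc, smul_zero]⟩ }
  have hJ : ∀ y ∈ J, ∀ c ∈ K, y * c ∈ J := fun y hy c hc =>
    ⟨hK.mul_mem y hy.1 c hc, fun d hd => by
      rw [mul_assoc]; exact hy.2 _ (hK.mul_mem c hc d hd)⟩
  have hΔ : ∀ y ∈ J, Coalgebra.comul (R := k) y ∈ tensorSub k J K := fun y hy => by
    refine mem_tensorSub_of_forall (fun ξ => hK.isSubcoalgebra.hitLeft_mem ξ hy.1)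
      fun ξ => ⟨hK.isSubcoalgebra.hitRight_mem ξ hy.1, fun c hc => ?_⟩
    have h1 := hitLeft_mulRight hK.isSubcoalgebra (T := t) (x := y)
      (fun x hx => ht.right _ (hK.mul_mem y hy.1 x hx)) hc
    have h2 : hitLeft (t ∘ₗ LinearMap.mulLeft k y) c = 0 := by
      refine (tensorSub_le fun u hu v _ => ?_ : _ ≤ LinearMap.ker (contractLeft _))
        (hK.isSubcoalgebra c hc)
      rw [LinearMap.mem_ker, contractLeft_tmul, LinearMap.comp_apply, LinearMap.mulLeft_apply,
        hy.2 u hu, zero_smul]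
    rw [h2, map_zero] at h1
    have h3 := apply_hitLeft (t ∘ₗ LinearMap.mulRight k c) ξ y
    rw [h1, map_zero] at h3
    exact h3.symm
  have hε : ∀ y ∈ J, Coalgebra.counit (R := k) y = 0 := fun y hy => by
    have h1 : LinearMap.mul' k H ((HopfAlgebra.antipode k).lTensor H
        (Coalgebra.comul (R := k) y)) ∈ J := by
      refine (tensorSub_le fun u hu v hv => ?_ : _ ≤ J.comap
        (LinearMap.mul' k H ∘ₗ (HopfAlgebra.antipode k).lTensor H)) (hΔ y hy)
      exact hJ u hu _ (hK.antipode_mem v hv)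
    rw [HopfAlgebra.mul_antipode_lTensor_comul_apply] at h1
    have h2 := h1.2 1 hK.one_mem
    rwa [mul_one, Algebra.algebraMap_eq_smul_one, map_smul, ht.map_one, smul_eq_mul,
      mul_one] at h2
  have hyJ : y ∈ J := ⟨hy, h⟩
  rw [← hitLeft_counit (k := k) y]
  refine (tensorSub_le fun u hu v _ => ?_ : _ ≤ LinearMap.ker (contractLeft _)) (hΔ y hyJ)
  rw [LinearMap.mem_ker, contractLeft_tmul, hε u hu, zero_smul]

theorem isSubcoalgebra_span_one : IsSubcoalgebra k (Submodule.span k {(1 : H)}) := by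
  intro d hd
  obtain ⟨a, rfl⟩ := Submodule.mem_span_singleton.1 hd
  rw [map_smul, Bialgebra.comul_one]
  exact Submodule.smul_mem _ _ (tmul_mem_tensorSub (Submodule.mem_span_singleton_self _)
    (Submodule.mem_span_singleton_self _))

/-- The line `k 1` has a complement among the subcoalgebras of the coradical. -/
theorem exists_subcoalgebra_compl_one : ∃ E : Submodule k H, IsSubcoalgebra k E ∧ (1 : H) ∉ E ∧
    coradical k H ≤ E ⊔ Submodule.span k {(1 : H)} := by
  have hnt : (1 : H) ≠ 0 := by
    intro h
    have := Bialgebra.counit_one (R := k) (A := H)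
    rw [h, map_zero] at this
    exact zero_ne_one this
  -- `E` is maximal among the subcoalgebras that avoid `1`.
  obtain ⟨E, -, hE⟩ := zorn_le_nonempty₀ {E : Submodule k H | IsSubcoalgebra k E ∧ (1 : H) ∉ E}
    (fun c hc hchain D hD => ⟨sSup c, ⟨isSubcoalgebra_sSup fun E hE => (hc hE).1, fun h1 => by
      obtain ⟨E, hE, h1⟩ := (Submodule.mem_sSup_of_directed ⟨D, hD⟩ hchain.directedOn).1 h1
      exact (hc hE).2 h1⟩, fun E hE => le_sSup hE⟩)
    ⊥ ⟨fun d hd => by rw [(Submodule.mem_bot k).1 hd, map_zero]; exact Submodule.zero_mem _,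
      fun h => hnt ((Submodule.mem_bot k).1 h)⟩
  refine ⟨E, hE.1.1, hE.1.2, sSup_le fun D hD => ?_⟩
  -- A simple `D` either lies in `E + k 1` or meets it trivially. In the second case `1 = e + d`
  -- would put `d = 1 - e` in that intersection, so `E + D` still avoids `1` and maximality gives `D
  -- ≤ E`.
  rcases hD.2.2 _ (hD.1.inf (hE.1.1.sup isSubcoalgebra_span_one)) inf_le_left with h | h
  · have h1 : (1 : H) ∉ E ⊔ D := fun h1 => by
      obtain ⟨e, he, d, hd, hed⟩ := Submodule.mem_sup.1 h1
      have hd' : d ∈ D ⊓ (E ⊔ Submodule.span k {(1 : H)}) := by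
        refine ⟨hd, ?_⟩
        rw [← add_sub_cancel_left e d, hed, sub_eq_add_neg, add_comm]
        exact Submodule.add_mem_sup (E.neg_mem he) (Submodule.mem_span_singleton_self _)
      rw [h] at hd'
      rw [(Submodule.mem_bot k).1 hd', add_zero] at hed
      exact hE.1.2 (hed ▸ he)
    have h2 := hE.2 (y := E ⊔ D) ⟨hE.1.1.sup hD.1, h1⟩ le_sup_left
    exact (le_sup_right.trans h2).trans le_sup_left
  · exact inf_eq_left.1 h

/-- A Hopf algebra has a normalized two-sided integral on its coradical. -/
theorem exists_isHaar_coradical : ∃ t : H →ₗ[k] k, IsHaar (coradical k H) t := by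
  obtain ⟨E, hE, h1, hle⟩ := exists_subcoalgebra_compl_one (k := k) (H := H)
  obtain ⟨f, hf1, hf⟩ := Submodule.exists_le_ker_of_notMem h1
  -- `t` is zero on `E` and `1` at `1`. On the subcoalgebra `E` both sides of the integral
  -- identities vanish; at `1` they hold because `1` is grouplike.
  let t : H →ₗ[k] k := (f 1)⁻¹ • f
  have ht1 : t 1 = 1 := inv_mul_cancel₀ hf1
  have htE : ∀ e ∈ E, t e = 0 := fun e he => by
    have : f e = 0 := hf he
    simp [t, this]
  have h1l : hitRight t (1 : H) = 1 := by
    rw [hitRight_apply, Bialgebra.comul_one, Algebra.TensorProduct.one_def, contractRight_tmul, ht1,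
      one_smul]
  have h1r : hitLeft t (1 : H) = 1 := by
    rw [hitLeft_apply, Bialgebra.comul_one, Algebra.TensorProduct.one_def, contractLeft_tmul, ht1,
      one_smul]
  refine ⟨t, ht1, fun x hx => ?_, fun x hx => ?_⟩ <;>
    obtain ⟨e, he, a, ha, rfl⟩ := Submodule.mem_sup.1 (hle hx) <;>
    obtain ⟨a, rfl⟩ := Submodule.mem_span_singleton.1 ha
  · have h0 : hitRight t e = 0 := by
      refine (tensorSub_le fun u _ v hv => ?_ : _ ≤ LinearMap.ker (contractRight _)) (hE e he)
      rw [LinearMap.mem_ker, contractRight_tmul, htE v hv, zero_smul]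
    rw [map_add, map_smul, h0, h1l, zero_add, map_add, htE e he, map_smul, ht1]
    simp
  · have h0 : hitLeft t e = 0 := by
      refine (tensorSub_le fun u hu v _ => ?_ : _ ≤ LinearMap.ker (contractLeft _)) (hE e he)
      rw [LinearMap.mem_ker, contractLeft_tmul, htE u hu, zero_smul]
    rw [map_add, map_smul, h0, h1r, zero_add, map_add, htE e he, map_smul, ht1]
    simp

end Integrals

/-! ### Exhaustiveness of the coradical filtration -/

section Exhaustion

variable {k : Type*} [Field k] {C : Type*} [AddCommGroup C] [Module k C]

theorem mem_of_forall_functional {W : Submodule k C} {x : C}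
    (h : ∀ f : C →ₗ[k] k, (∀ w ∈ W, f w = 0) → f x = 0) : x ∈ W := by
  by_contra hx
  obtain ⟨f, hfx, hf⟩ := Submodule.exists_le_ker_of_notMem hx
  exact hfx (h f fun w hw => hf hw)

theorem exists_fg_mem_tensorSub (s : C ⊗[k] C) :
    ∃ V : Submodule k C, V.FG ∧ s ∈ tensorSub k V V := by
  induction s with
  | zero => exact ⟨⊥, Submodule.fg_bot, Submodule.zero_mem _⟩
  | tmul x y =>
    exact ⟨Submodule.span k {x, y}, Submodule.fg_span (by simp), tmul_mem_tensorSub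
      (Submodule.subset_span (by simp)) (Submodule.subset_span (by simp))⟩
  | add s t hs ht =>
    obtain ⟨V, hV, hs⟩ := hs
    obtain ⟨W, hW, ht⟩ := ht
    exact ⟨V ⊔ W, hV.sup hW, Submodule.add_mem _ (tensorSub_mono le_sup_left le_sup_left hs)
      (tensorSub_mono le_sup_right le_sup_right ht)⟩

theorem exists_fg_map_le_tensorSub (f : C →ₗ[k] C ⊗[k] C) {X : Submodule k C} (hX : X.FG) :
    ∃ V : Submodule k C, V.FG ∧ ∀ x ∈ X, f x ∈ tensorSub k V V := by
  induction X, hX using Submodule.fg_induction with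
  | singleton x =>
    obtain ⟨V, hV, h⟩ := exists_fg_mem_tensorSub (f x)
    refine ⟨V, hV, fun y hy => ?_⟩
    obtain ⟨a, rfl⟩ := Submodule.mem_span_singleton.1 hy
    rw [map_smul]
    exact Submodule.smul_mem _ _ h
  | sup X Y _ _ hX hY =>
    obtain ⟨V, hV, h⟩ := hX
    obtain ⟨W, hW, h'⟩ := hY
    refine ⟨V ⊔ W, hV.sup hW, fun z hz => ?_⟩
    obtain ⟨x, hx, y, hy, rfl⟩ := Submodule.mem_sup.1 hz
    rw [map_add]
    exact Submodule.add_mem _ (tensorSub_mono le_sup_left le_sup_left (h x hx))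
      (tensorSub_mono le_sup_right le_sup_right (h' y hy))

variable [Coalgebra k C]

variable (k C) in
/-- The dual of a coalgebra, with the convolution product. -/
def ConvDual : Type _ := WithConv (C →ₗ[k] k)

instance : Ring (ConvDual k C) := inferInstanceAs (Ring (WithConv (C →ₗ[k] k)))

instance : Algebra k (ConvDual k C) :=
  let _ : Algebra k (WithConv (C →ₗ[k] k)) := LinearMap.convAlgebra
  inferInstanceAs (Algebra k (WithConv (C →ₗ[k] k)))

/-- The action `α ⇀ c = c₁ α(c₂)` of the convolution algebra `C^*` on `C`. -/
instance convModule : Module (ConvDual k C) C where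
  smul a c := hitRight a.ofConv c
  one_smul c := by
    change hitRight (Algebra.linearMap k k ∘ₗ Coalgebra.counit) c = c
    exact hitRight_counit c
  mul_smul a b c := by
    change hitRight (a * b).ofConv c = hitRight a.ofConv (hitRight b.ofConv c)
    rw [hitRight_hitRight]
    have e : LinearMap.mul' k k ∘ₗ TensorProduct.map a.ofConv b.ofConv =
        a.ofConv ∘ₗ contractRight b.ofConv := by
      ext x y
      simp [mul_comm]
    have e' : (a * b).ofConv = a.ofConv ∘ₗ hitRight b.ofConv :=
      LinearMap.ext fun x => LinearMap.congr_fun e (Coalgebra.comul (R := k) x)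
    rw [e']
  smul_zero a := map_zero (hitRight a.ofConv)
  smul_add a := map_add (hitRight a.ofConv)
  add_smul a b c := by
    change contractRight (a.ofConv + b.ofConv) (Coalgebra.comul (R := k) c) = _
    have e : contractRight (V := C) (a.ofConv + b.ofConv) =
        contractRight a.ofConv + contractRight b.ofConv := by
      ext x y
      simp [add_smul]
    rw [e]
    rfl
  zero_smul c := by
    change contractRight 0 (Coalgebra.comul (R := k) c) = 0
    have e : contractRight (V := C) (0 : C →ₗ[k] k) = 0 := by
      ext x y
      simp
    rw [e]
    rfl

theorem conv_smul_def (a : ConvDual k C) (c : C) : a • c = hitRight a.ofConv c := rfl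

instance : IsScalarTower k (ConvDual k C) C where
  smul_assoc r a c := by
    change contractRight (r • a.ofConv) (Coalgebra.comul (R := k) c) = _
    have e : contractRight (V := C) (r • a.ofConv) = r • contractRight a.ofConv := by
      ext x y
      simp [mul_smul]
    rw [e]
    rfl

/-- A subspace that is stable under all `c ↦ c₁ ξ(c₂)`, as a submodule over `C^*`. -/
def convSubmodule (U : Submodule k C) (hU : ∀ (ξ : C →ₗ[k] k), ∀ u ∈ U, hitRight ξ u ∈ U) :
    Submodule (ConvDual k C) C where
  carrier := U
  zero_mem' := U.zero_mem
  add_mem' := U.add_mem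
  smul_mem' a _ hu := hU a.ofConv _ hu

/-- `c ↦ ξ(c₁) c₂` is linear over `C^*`. -/
def convHitLeft (ξ : C →ₗ[k] k) : C →ₗ[ConvDual k C] C where
  toFun := hitLeft ξ
  map_add' := map_add _
  map_smul' a c := hitLeft_hitRight ξ a.ofConv c

/-- Local finiteness: if `Δ c` is in `V ⊗ V`, then every `c₁ α(c₂)` is in `V`. -/
theorem finiteDimensional_span_conv (c : C) :
    ((Submodule.span (ConvDual k C) {c}).restrictScalars k).FG := by
  obtain ⟨V, hV, hc⟩ := exists_fg_mem_tensorSub (Coalgebra.comul (R := k) c)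
  have : FiniteDimensional k V := Module.Finite.iff_fg.2 hV
  refine Module.Finite.iff_fg.1 (Submodule.finiteDimensional_of_le (S₂ := V) fun x hx => ?_)
  obtain ⟨a, rfl⟩ := Submodule.mem_span_singleton.1 hx
  exact contractRight_mem hc a.ofConv

/-- A subcoalgebra `U ≠ C` is properly contained in `U ∧ C₀`. -/
theorem exists_mem_wedge_coradical {U : Submodule k C} (hU : IsSubcoalgebra k U) (hne : U ≠ ⊤) :
    ∃ c ∈ wedge k U (coradical k C), c ∉ U := by
  let UA : Submodule (ConvDual k C) C := convSubmodule U fun ξ _ hu => hU.hitRight_mem ξ hu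
  -- a minimal finite-dimensional submodule not contained in `U`
  obtain ⟨X, ⟨hXfg, hXU⟩, hXmin⟩ : ∃ X : Submodule (ConvDual k C) C,
      ((X.restrictScalars k).FG ∧ ¬ X ≤ UA) ∧ ∀ Y : Submodule (ConvDual k C) C, Y < X → Y ≤ UA := by
    obtain ⟨c, -, hc⟩ := SetLike.exists_of_lt (lt_top_iff_ne_top.2 hne)
    let P : Submodule (ConvDual k C) C → Prop := fun X => (X.restrictScalars k).FG ∧ ¬ X ≤ UA
    obtain ⟨X, hX, hmin⟩ := WellFounded.has_min
      (measure fun X : Submodule (ConvDual k C) C =>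
        Module.finrank k (X.restrictScalars k)).wf {X | P X}
      ⟨Submodule.span (ConvDual k C) {c}, finiteDimensional_span_conv c,
        fun h => hc (h (Submodule.mem_span_singleton_self c))⟩
    refine ⟨X, hX, fun Y hY => ?_⟩
    by_contra hYU
    have : FiniteDimensional k (X.restrictScalars k) := Module.Finite.iff_fg.2 hX.1
    have hlt : Y.restrictScalars k < X.restrictScalars k := hY
    exact hmin Y ⟨Module.Finite.iff_fg.1 (Submodule.finiteDimensional_of_le hlt.le), hYU⟩
      (Submodule.finrank_lt_finrank_of_lt hlt)
  obtain ⟨x₀, hx₀, hx₀U⟩ := SetLike.not_le_iff_exists.1 hXU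
  let Q : Submodule (ConvDual k C) X := UA.comap X.subtype
  -- By minimality every proper submodule of `X` lies in `U`, hence in `Q`; so `X ⧸ Q` is simple.
  have hQ : IsCoatom Q := by
    refine ⟨fun h => hx₀U ((h ▸ Submodule.mem_top : (⟨x₀, hx₀⟩ : X) ∈ Q)), fun Y hY => ?_⟩
    by_contra hYtop
    refine hY.not_ge fun y hy => ?_
    have h1 : Y.map X.subtype < X := by
      refine lt_of_le_of_ne (Submodule.map_subtype_le X Y) fun h => hYtop ?_
      rw [eq_top_iff]
      intro z _
      obtain ⟨y, hy, hyz⟩ := (h.symm ▸ z.2 : (z : C) ∈ Y.map X.subtype)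
      rwa [← Subtype.ext hyz]
    exact hXmin _ h1 (Submodule.mem_map_of_mem hy)
  have hsimple : IsSimpleModule (ConvDual k C) (X ⧸ Q) := isSimpleModule_iff_isCoatom.2 hQ
  -- the subcoalgebra of coefficients of `X ⧸ Q`
  let G : Set C := {c | ∃ α : C →ₗ[k] k, (∀ u ∈ U, α u = 0) ∧ ∃ x ∈ X, hitLeft α x = c}
  have hkill : ∀ α : C →ₗ[k] k, (∀ u ∈ U, α u = 0) → ∀ u ∈ U, hitLeft α u = 0 := by
    intro α hα u hu
    refine (tensorSub_le fun a ha b _ => ?_ : _ ≤ LinearMap.ker (contractLeft α)) (hU u hu)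
    rw [LinearMap.mem_ker, contractLeft_tmul, hα a ha, zero_smul]
  have hG : IsSubcoalgebra k (Submodule.span k G) := by
    refine isSubcoalgebra_iff.2 ⟨fun ξ => ?_, fun ξ => ?_⟩
    · refine (Submodule.span_le.2 ?_ : _ ≤ (Submodule.span k G).comap (hitLeft ξ))
      rintro _ ⟨α, hα, x, hx, rfl⟩
      refine Submodule.subset_span ⟨ξ ∘ₗ hitLeft α, fun u hu => ?_, x, hx,
        (hitLeft_hitLeft ξ α x).symm⟩
      rw [LinearMap.comp_apply, hkill α hα u hu, map_zero]
    · refine (Submodule.span_le.2 ?_ : _ ≤ (Submodule.span k G).comap (hitRight ξ))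
      rintro _ ⟨α, hα, x, hx, rfl⟩
      exact Submodule.subset_span ⟨α, hα, hitRight ξ x, X.smul_mem (WithConv.toConv ξ) hx,
        hitLeft_hitRight α ξ x⟩
  -- Otherwise `α(x₀) = ε(α(x₀₁) x₀₂) = 0` for all `α` that vanish on `U`, which would put `x₀` in
  -- `U`.
  have hGne : Submodule.span k G ≠ ⊥ := fun h => hx₀U <| mem_of_forall_functional fun α hα => by
    have h1 : hitLeft α x₀ ∈ Submodule.span k G := Submodule.subset_span ⟨α, hα, x₀, hx₀, rfl⟩
    rw [h, Submodule.mem_bot] at h1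
    rw [← counit_hitLeft, h1, map_zero]
  have : FiniteDimensional k (Submodule.span k G) := by
    obtain ⟨V, hV, h⟩ := exists_fg_map_le_tensorSub (Coalgebra.comul (R := k)) hXfg
    have : FiniteDimensional k V := Module.Finite.iff_fg.2 hV
    refine Submodule.finiteDimensional_of_le (S₂ := V) (Submodule.span_le.2 ?_)
    rintro _ ⟨α, -, x, hx, rfl⟩
    exact contractLeft_mem (h x hx) α
  obtain ⟨D, hDG, hD⟩ := exists_isSimpleSubcoalgebra_le hG hGne
  -- `X ⧸ Q` embeds into the simple subcoalgebra `D`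
  let I : Submodule (ConvDual k C) C := isotypicComponent (ConvDual k C) C (X ⧸ Q)
  -- Each `α` that kills `U` induces a `C^*`-linear map `x ↦ α(x₁) x₂` from `X ⧸ Q` to `C`, which is
  -- injective or zero. So the coefficients lie in the isotypic component of `C` of type `X ⧸ Q`.
  have hDI : D ≤ I.restrictScalars k := by
    refine hDG.trans (Submodule.span_le.2 ?_)
    rintro _ ⟨α, hα, x, hx, rfl⟩
    let f : (X ⧸ Q) →ₗ[ConvDual k C] C :=
      Q.liftQ (convHitLeft α ∘ₗ X.subtype) fun y hy => hkill α hα _ hy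
    change f (Q.mkQ ⟨x, hx⟩) ∈ I
    rcases LinearMap.injective_or_eq_zero f with hf | hf
    · exact (le_sSup ⟨(LinearEquiv.ofInjective f hf).symm⟩ : LinearMap.range f ≤ I)
        (LinearMap.mem_range_self _ _)
    · rw [hf]
      exact I.zero_mem
  -- `D` is a nonzero submodule of a semisimple isotypic module, so it contains a simple submodule,
  -- necessarily isomorphic to `X ⧸ Q`.
  obtain ⟨g, hg, hgD⟩ : ∃ g : (X ⧸ Q) →ₗ[ConvDual k C] C, Function.Injective g ∧ ∀ y, g y ∈ D := by
    let DA : Submodule (ConvDual k C) C := convSubmodule D fun ξ _ hd => hD.1.hitRight_mem ξ hd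
    let DI : Submodule (ConvDual k C) I := DA.comap I.subtype
    have hDI0 : DI ≠ ⊥ := fun h => hD.2.1 <| (Submodule.eq_bot_iff D).2 fun d hd => by
      have h1 : (⟨d, hDI hd⟩ : I) ∈ DI := hd
      rw [h, Submodule.mem_bot] at h1
      exact congrArg Subtype.val h1
    obtain ⟨m, hm, hmD⟩ := (IsAtomic.eq_bot_or_exists_atom_le DI).resolve_left hDI0
    have : IsSimpleModule (ConvDual k C) m := isSimpleModule_iff_isAtom.2 hm
    obtain ⟨e⟩ := IsIsotypicOfType.isotypicComponent (ConvDual k C) C (X ⧸ Q) m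
    exact ⟨I.subtype ∘ₗ m.subtype ∘ₗ e.symm.toLinearMap,
      (Submodule.injective_subtype I).comp ((Submodule.injective_subtype m).comp e.symm.injective),
      fun y => hmD (e.symm y).2⟩
  refine ⟨x₀, ?_, hx₀U⟩
  rw [mem_wedge]
  refine eq_zero_of_forall_contractLeft fun ξ => ?_
  rw [contractLeft_map]
  refine (Submodule.Quotient.mk_eq_zero _).2 ((le_sSup hD : D ≤ coradical k C)
    (mem_of_forall_functional fun a ha => ?_))
  change a (hitLeft (ξ ∘ₗ U.mkQ) x₀) = 0
  rw [apply_hitLeft]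
  let b : ConvDual k C := WithConv.toConv a
  -- A functional `a` that vanishes on the subcoalgebra `D` annihilates `D` as a module, hence also
  -- its submodule `X ⧸ Q`. So `x₀₁ a(x₀₂)` is in `U` for all such `a`, which is what `x₀ ∈ U ∧ D`
  -- requires.
  have h1 : b • Q.mkQ ⟨x₀, hx₀⟩ = 0 := by
    apply hg
    rw [map_smul, map_zero, conv_smul_def]
    refine (tensorSub_le fun u _ v hv => ?_ : _ ≤ LinearMap.ker (contractRight a))
      (hD.1 _ (hgD (Q.mkQ ⟨x₀, hx₀⟩)))
    rw [LinearMap.mem_ker, contractRight_tmul, ha v hv, zero_smul]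
  rw [← map_smul] at h1
  have h2 : hitRight a x₀ ∈ U := (Submodule.Quotient.mk_eq_zero Q).1 h1
  rw [LinearMap.comp_apply, Submodule.mkQ_apply, (Submodule.Quotient.mk_eq_zero U).2 h2, map_zero]

theorem isSubcoalgebra_coradFilPred (n : ℕ) : IsSubcoalgebra k (coradFilPred k C n) := by
  intro c hc
  cases n with
  | zero => rw [(Submodule.mem_bot k).1 hc, map_zero]; exact Submodule.zero_mem _
  | succ n =>
    exact comul_mem_of_forall (fun i j hij u hu v hv => tmul_mem_tensorSub
      (coradFil_mono (by omega : i ≤ n) hu) (coradFil_mono (by omega : j ≤ n) hv)) hc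

/-- The coradical filtration of a coalgebra is exhaustive. -/
theorem exists_mem_coradFilPred (c : C) : ∃ n, c ∈ coradFilPred k C n := by
  let U : Submodule k C := ⨆ n, coradFilPred k C n
  have hdir : Directed (· ≤ ·) (coradFilPred k C) := coradFilPred_mono.directed_le
  rw [← Submodule.mem_iSup_of_directed _ hdir]
  change c ∈ U
  suffices h : U = ⊤ by rw [h]; exact Submodule.mem_top
  by_contra hne
  have hU : IsSubcoalgebra k U := isSubcoalgebra_sSup (by
    rintro _ ⟨n, rfl⟩
    exact isSubcoalgebra_coradFilPred n)
  obtain ⟨c, hc, hcU⟩ := exists_mem_wedge_coradical hU hne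
  refine hcU ?_
  have h1 := mem_sup_of_map_mkQ_eq_zero (U := ⊤) (tensorSub_top_top (k := k) (C := C) ▸ trivial)
    (mem_wedge.1 hc)
  obtain ⟨s, hs, t, ht, hst⟩ := Submodule.mem_sup.1 h1
  -- A tensor in `U ⊗ C` involves finitely many elements of the union `U`, so a single layer
  -- contains them all and `c` is already in the next layer.
  obtain ⟨n, hn⟩ : ∃ n, s ∈ tensorSub k (coradFilPred k C n) ⊤ := by
    have hmono : Monotone fun n => tensorSub k (coradFilPred k C n) ⊤ :=
      fun _ _ h => tensorSub_mono (coradFilPred_mono h) le_rfl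
    rw [← Submodule.mem_iSup_of_directed _ hmono.directed_le]
    refine tensorSub_le (fun u hu v _ => ?_) hs
    obtain ⟨n, hn⟩ := (Submodule.mem_iSup_of_directed _ hdir).1 hu
    exact Submodule.mem_iSup_of_mem n (tmul_mem_tensorSub hn trivial)
  refine Submodule.mem_iSup_of_mem (n + 1) ?_
  rw [coradFilPred_succ, mem_wedge, ← hst]
  exact map_mkQ_eq_zero_of_mem (Submodule.add_mem_sup hn ht)

end Exhaustion

/-! ### Integrals on filtered Hopf algebras -/

section FilteredHopf

variable {k : Type*} [Field k] {H : Type*} [Ring H] [HopfAlgebra k H]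

/-- An exhaustive Hopf algebra filtration `0 = F 0 ≤ F 1 ≤ ...` with `F 1 ≤ K`. -/
structure IsHopfFiltration (K : Submodule k H) (F : ℕ → Submodule k H) : Prop where
  zero : F 0 = ⊥
  mono : Monotone F
  exhaustive : ∀ x, ∃ n, x ∈ F n
  mul_mem : ∀ n, ∀ x ∈ F n, ∀ y ∈ K, x * y ∈ F n
  antipode_mem : ∀ n, ∀ x ∈ F n, HopfAlgebra.antipode k x ∈ F n
  isSubcoalgebra : ∀ n, IsSubcoalgebra k (F n)
  comul_right : ∀ n, ∀ x ∈ F (n + 1), Coalgebra.comul (R := k) x ∈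
    tensorSub k (F n) ⊤ ⊔ tensorSub k ⊤ K
  comul_left : ∀ n, ∀ x ∈ F (n + 1), Coalgebra.comul (R := k) x ∈
    tensorSub k K ⊤ ⊔ tensorSub k ⊤ (F n)

/-- A left integral `T` with `T h ≠ 0` yields a functional `y ↦ T(h' y)` that agrees on `K` with a
multiple of the integral of `K`. -/
theorem IsHaar.exists_mulLeft_eq {K : Submodule k H} {t : H →ₗ[k] k}
    (ht : IsHaar K t) {T : H →ₗ[k] k} (hT : ∀ h, hitRight T h = T h • 1) {D : Submodule k H}
    (hD : IsSubcoalgebra k D) {h : H} (hh : h ∈ D) :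
    ∃ h' ∈ D, ∀ y ∈ K, T (h' * y) = t y * T h := by
  -- With `h' = t(S(h₁)) h₂` one has `T(h' y) = t(S(h₁)) T(h₂ y) = t(y₁) T(h y₂) = t(y) T(h)`: the
  -- exchange formula, then the right integral property of `t` on `K`.
  refine ⟨hitLeft (t ∘ₗ HopfAlgebra.antipode k) h, hD.hitLeft_mem _ hh, fun y hy => ?_⟩
  have h1 := hitRight_mulLeft (K := (⊤ : Submodule k H)) (T := T) (x := h) (y := y)
    (fun d _ => by rw [tensorSub_top_top]; trivial) (fun x _ => hT _) trivial
  have h2 := apply_hitLeft (t ∘ₗ HopfAlgebra.antipode k) (T ∘ₗ LinearMap.mulRight k y) h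
  have h3 := apply_hitLeft t (T ∘ₗ LinearMap.mulLeft k h) y
  rw [h1] at h3
  rw [LinearMap.comp_apply, LinearMap.mulRight_apply, LinearMap.comp_apply, ← h3, ht.right y hy,
    map_smul, LinearMap.comp_apply, LinearMap.mulLeft_apply, mul_one, smul_eq_mul] at h2
  exact h2

/-- The filtration stops at any layer `F n` that contains an `h` with `T h ≠ 0`. Replacing `h` by
`h'` makes `T(h' ·)` proportional to `t` on `K`, which brings in the nondegeneracy of `t`. -/
theorem IsHopfFiltration.exists_eq_top {K : Submodule k H} {F : ℕ → Submodule k H}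
    (hF : IsHopfFiltration K F) (hK : IsHopfSubalgebra k K) {t : H →ₗ[k] k} (ht : IsHaar K t)
    (hco : IsCoFrobenius k H) : ∃ n, F n = ⊤ := by
  obtain ⟨T, hT0, hT⟩ := isCoFrobenius_iff.1 hco
  obtain ⟨h, hh⟩ : ∃ h, T h ≠ 0 := by
    by_contra! hcon
    exact hT0 (LinearMap.ext hcon)
  obtain ⟨n, hn⟩ := hF.exhaustive h
  obtain ⟨h', hh', hT'⟩ := ht.exists_mulLeft_eq hT (hF.isSubcoalgebra n) hn
  -- By the exchange formula this element is the antipode of `x₁ T(x₂ y)` with `x = h' c` in `F n`;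
  -- the bound does not depend on `y`.
  have hmem : ∀ c ∈ K, ∀ y, hitRight (T ∘ₗ LinearMap.mulLeft k (h' * c)) y ∈ F n := by
    intro c hc y
    rw [hitRight_mulLeft (K := (⊤ : Submodule k H)) (fun d _ => by rw [tensorSub_top_top]; trivial)
      (fun x _ => hT _) trivial]
    exact hF.antipode_mem n _
      ((hF.isSubcoalgebra n).hitRight_mem _ (hF.mul_mem n _ hh' c hc))
  have hstep : ∀ m, n ≤ m → F (m + 1) ≤ F m := by
    intro m hm y hy
    refine mem_of_forall_functional fun ξ hξ => ?_
    -- `ξ(y₁) y₂` lies in `K` and is orthogonal to `K`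
    have hyK : hitLeft ξ y ∈ K := by
      refine (sup_le (tensorSub_le fun a ha b _ => ?_) (tensorSub_le fun a _ b hb => ?_) :
        _ ≤ K.comap (contractLeft ξ)) (hF.comul_right m y hy)
      · rw [Submodule.mem_comap, contractLeft_tmul, hξ a ha, zero_smul]
        exact K.zero_mem
      · rw [Submodule.mem_comap, contractLeft_tmul]
        exact K.smul_mem _ hb
    have h0 : hitLeft ξ y = 0 := by
      -- For `z = ξ(y₁) y₂`: `t(c z) T(h) = T(h' c z) = ξ(y₁ T(h' c y₂))`, and `ξ` kills `F n ≤ F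
      -- m`.
      refine ht.eq_zero_of_mul_left hK hyK fun c hc => ?_
      have h1 := apply_hitLeft ξ (T ∘ₗ LinearMap.mulLeft k (h' * c)) y
      rw [hξ _ (hF.mono hm (hmem c hc y)), LinearMap.comp_apply, LinearMap.mulLeft_apply, mul_assoc,
        hT' _ (hK.mul_mem c hc _ hyK)] at h1
      exact (mul_eq_zero.1 h1).resolve_right hh
    rw [← counit_hitLeft, h0, map_zero]
  have hle : ∀ m, F (n + m) ≤ F n := by
    intro m
    induction m with
    | zero => exact le_rfl
    | succ m ih => exact (hstep (n + m) (by omega)).trans ih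
  refine ⟨n, eq_top_iff.2 fun x _ => ?_⟩
  obtain ⟨m, hm⟩ := hF.exhaustive x
  exact hle m (hF.mono (by omega : m ≤ n + m) hm)

/-- The map `h ↦ g(h S(c₁)) c₂`. -/
def twist (g : H →ₗ[k] H) (c : H) : H →ₗ[k] H :=
  LinearMap.mul' k H ∘ₗ g.rTensor H ∘ₗ
    LinearMap.mulRight k ((HopfAlgebra.antipode k).rTensor H (Coalgebra.comul (R := k) c)) ∘ₗ
      (TensorProduct.mk k H H).flip 1

theorem twist_apply (g : H →ₗ[k] H) (c h : H) : twist g c h = LinearMap.mul' k H (TensorProduct.map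
    (g ∘ₗ LinearMap.mulLeft k h ∘ₗ HopfAlgebra.antipode k) LinearMap.id
      (Coalgebra.comul (R := k) c)) := by
  have e : LinearMap.mul' k H ∘ₗ g.rTensor H ∘ₗ LinearMap.mulLeft k (h ⊗ₜ[k] (1 : H)) ∘ₗ
      (HopfAlgebra.antipode k).rTensor H = LinearMap.mul' k H ∘ₗ TensorProduct.map
        (g ∘ₗ LinearMap.mulLeft k h ∘ₗ HopfAlgebra.antipode k) LinearMap.id := by
    ext a b
    simp
  exact LinearMap.congr_fun e (Coalgebra.comul (R := k) c)

/-- Twisting preserves left colinearity. As `Δ(S c) = S(c₂) ⊗ S(c₁)`, the comultiplication of `g(h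
S(c₁)) c₂` is `h₁ S(c₂) c₃ ⊗ g(h₂ S(c₁)) c₄`, and the inner factors cancel to leave `h₁ ⊗ g(h₂
S(c₁)) c₂`. -/
theorem comul_twist {g : H →ₗ[k] H}
    (hg : ∀ h, Coalgebra.comul (R := k) (g h) = g.lTensor H (Coalgebra.comul (R := k) h))
    (c h : H) : Coalgebra.comul (R := k) (twist g c h) =
      (twist g c).lTensor H (Coalgebra.comul (R := k) h) := by
  let S := HopfAlgebra.antipode k (A := H)
  let Δ := Coalgebra.comul (R := k) (A := H)
  let i : H →ₗ[k] H ⊗[k] H := (TensorProduct.mk k H H).flip 1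
  let j : H →ₗ[k] H ⊗[k] H := TensorProduct.mk k H H 1
  -- `Φ s c = (id ⊗ g)(s Δ(S c))`
  let Φ : H ⊗[k] H → H →ₗ[k] H ⊗[k] H := fun s => g.lTensor H ∘ₗ LinearMap.mulLeft k s ∘ₗ Δ ∘ₗ S
  have h1 : Δ (twist g c h) =
      LinearMap.mul' k (H ⊗[k] H) (TensorProduct.map (Φ (Δ h)) Δ (Δ c)) := by
    have e : Δ ∘ₗ LinearMap.mul' k H ∘ₗ TensorProduct.map
        (g ∘ₗ LinearMap.mulLeft k h ∘ₗ S) LinearMap.id =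
        LinearMap.mul' k (H ⊗[k] H) ∘ₗ TensorProduct.map (Φ (Δ h)) Δ := by
      ext a b
      simp [Φ, Δ, hg]
    rw [twist_apply]
    exact LinearMap.congr_fun e (Δ c)
  have hj : WithConv.toConv i * WithConv.toConv j = WithConv.toConv Δ := by
    ext c
    have e : LinearMap.mul' k (H ⊗[k] H) ∘ₗ TensorProduct.map i j = LinearMap.id := by
      ext a b
      simp [i, j]
    exact LinearMap.congr_fun e (Δ c)
  have h2 : ∀ p q, LinearMap.mul' k (H ⊗[k] H) (TensorProduct.map (Φ (p ⊗ₜ q)) Δ (Δ c)) =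
      p ⊗ₜ twist g c q := by
    intro p q
    let A : H →ₗ[k] H := g ∘ₗ LinearMap.mulLeft k q ∘ₗ S
    -- As convolution products, `Φ (p ⊗ q) = (j A) * (i p S)` and `Δ = i * j`. In `Φ (p ⊗ q) * Δ`
    -- the middle factors `(i p S) * i` collapse to the scalar map `ε(c) (p ⊗ 1)`.
    have e1 : WithConv.toConv (j ∘ₗ A) * WithConv.toConv (i ∘ₗ LinearMap.mulLeft k p ∘ₗ S) =
        WithConv.toConv (Φ (p ⊗ₜ q)) := by
      ext c
      have e : LinearMap.mul' k (H ⊗[k] H) ∘ₗ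
          TensorProduct.map (j ∘ₗ A) (i ∘ₗ LinearMap.mulLeft k p ∘ₗ S) =
          g.lTensor H ∘ₗ LinearMap.mulLeft k (p ⊗ₜ q) ∘ₗ TensorProduct.map S S ∘ₗ
            (TensorProduct.comm k H H).toLinearMap := by
        ext a b
        simp [i, j, A]
      refine (LinearMap.congr_fun e (Δ c)).trans ?_
      simp only [Φ, LinearMap.comp_apply, LinearEquiv.coe_coe]
      rw [← comul_antipode]
    have e2 : WithConv.toConv (i ∘ₗ LinearMap.mulLeft k p ∘ₗ S) * WithConv.toConv i =
        WithConv.toConv (LinearMap.mulLeft k (p ⊗ₜ[k] (1 : H)) ∘ₗ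
          Algebra.linearMap k (H ⊗[k] H) ∘ₗ Coalgebra.counit) := by
      ext c
      have e : LinearMap.mul' k (H ⊗[k] H) ∘ₗ
          TensorProduct.map (i ∘ₗ LinearMap.mulLeft k p ∘ₗ S) i =
          i ∘ₗ LinearMap.mulLeft k p ∘ₗ LinearMap.mul' k H ∘ₗ S.rTensor H := by
        ext a b
        simp [i, mul_assoc]
      refine (LinearMap.congr_fun e (Δ c)).trans ?_
      simp only [LinearMap.comp_apply, Δ, S]
      rw [HopfAlgebra.mul_antipode_rTensor_comul_apply]
      simp [i, Algebra.algebraMap_eq_smul_one]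
    have e3 : LinearMap.mul' k (H ⊗[k] H) ∘ₗ TensorProduct.map
        (LinearMap.mulLeft k (p ⊗ₜ[k] (1 : H)) ∘ₗ
          Algebra.linearMap k (H ⊗[k] H) ∘ₗ Coalgebra.counit) j ∘ₗ Δ =
        LinearMap.mulLeft k (p ⊗ₜ[k] (1 : H)) ∘ₗ j := by
      have e : LinearMap.mul' k (H ⊗[k] H) ∘ₗ TensorProduct.map
          (LinearMap.mulLeft k (p ⊗ₜ[k] (1 : H)) ∘ₗ
            Algebra.linearMap k (H ⊗[k] H) ∘ₗ Coalgebra.counit) j =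
          LinearMap.mulLeft k (p ⊗ₜ[k] (1 : H)) ∘ₗ j ∘ₗ (TensorProduct.lid k H).toLinearMap ∘ₗ
            (Coalgebra.counit (R := k) (A := H)).rTensor H := by
        ext a b
        simp [j, Algebra.algebraMap_eq_smul_one]
      rw [← LinearMap.comp_assoc, e]
      ext c
      simp [Δ]
    have e4 : WithConv.toConv (Φ (p ⊗ₜ q)) * WithConv.toConv Δ = WithConv.toConv (j ∘ₗ A) *
        WithConv.toConv (LinearMap.mulLeft k (p ⊗ₜ[k] (1 : H)) ∘ₗ j) := by
      rw [← e1, ← hj, mul_assoc,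
        ← mul_assoc (WithConv.toConv (i ∘ₗ LinearMap.mulLeft k p ∘ₗ S)), e2]
      congr 1
      exact congrArg WithConv.toConv e3
    refine (LinearMap.congr_fun (congrArg WithConv.ofConv e4) c).trans ?_
    have e5 : LinearMap.mul' k (H ⊗[k] H) ∘ₗ TensorProduct.map (j ∘ₗ A)
        (LinearMap.mulLeft k (p ⊗ₜ[k] (1 : H)) ∘ₗ j) =
        TensorProduct.mk k H H p ∘ₗ LinearMap.mul' k H ∘ₗ TensorProduct.map A LinearMap.id := by
      ext a b
      simp [j]
    rw [twist_apply]
    exact LinearMap.congr_fun e5 (Δ c)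
  -- Linearity in `s = Δ h` reduces the identity to the pure tensors treated in `h2`.
  let L : H ⊗[k] H →ₗ[k] H ⊗[k] H :=
    { toFun := fun s => LinearMap.mul' k (H ⊗[k] H) (TensorProduct.map (Φ s) Δ (Δ c))
      map_add' := fun s t => by
        have e : Φ (s + t) = Φ s + Φ t := by
          ext x; simp [Φ, add_mul]
        rw [e, TensorProduct.map_add_left, LinearMap.add_apply, map_add]
      map_smul' := fun r s => by
        have e : Φ (r • s) = r • Φ s := by
          ext x; simp [Φ]
        rw [e, TensorProduct.map_smul_left, LinearMap.smul_apply, map_smul]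
        rfl }
  have h4 : L = (twist g c).lTensor H := by
    ext p q
    exact h2 p q
  exact h1.trans (LinearMap.congr_fun h4 (Δ h))

/-- If `t(g(h S(c₁)) c₂) = 0` for all `h` and all `c` in `K`, then `t(g(h) c) = 0`, since
`g(h c₁ S(c₂)) c₃ = g(h) c`. -/
theorem apply_mul_eq_zero_of_twist {K : Submodule k H} (hK : IsSubcoalgebra k K) {t : H →ₗ[k] k}
    {g : H →ₗ[k] H} (h0 : ∀ c ∈ K, ∀ h, t (twist g c h) = 0) (h : H) {c : H} (hc : c ∈ K) :
    t (g h * c) = 0 := by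
  let S := HopfAlgebra.antipode k (A := H)
  let Δ := Coalgebra.comul (R := k) (A := H)
  let Q : H ⊗[k] H →ₗ[k] H := LinearMap.mul' k H ∘ₗ (g ∘ₗ LinearMap.mulLeft k h).rTensor H
  let E : H ⊗[k] H →ₗ[k] H := Q ∘ₗ (LinearMap.mul' k H ∘ₗ S.lTensor H).rTensor H ∘ₗ
    (TensorProduct.assoc k H H H).symm.toLinearMap ∘ₗ Δ.lTensor H
  have hE : ∀ a c, E (a ⊗ₜ c) = twist g c (h * a) := by
    intro a c
    have e : Q ∘ₗ (LinearMap.mul' k H ∘ₗ S.lTensor H).rTensor H ∘ₗ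
        (TensorProduct.assoc k H H H).symm.toLinearMap ∘ₗ TensorProduct.mk k H (H ⊗[k] H) a =
        LinearMap.mul' k H ∘ₗ TensorProduct.map (g ∘ₗ LinearMap.mulLeft k (h * a) ∘ₗ S)
          LinearMap.id := by
      ext x y
      simp [Q]
    rw [twist_apply]
    exact LinearMap.congr_fun e (Δ c)
  have hEc : E (Δ c) = g h * c := by
    simp only [E, LinearMap.comp_apply, LinearEquiv.coe_coe, Δ]
    rw [Coalgebra.coassoc_symm_apply]
    have e : (LinearMap.mul' k H ∘ₗ S.lTensor H).rTensor H ∘ₗ Δ.rTensor H =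
        (Algebra.linearMap k H).rTensor H ∘ₗ (Coalgebra.counit (R := k) (A := H)).rTensor H := by
      rw [← LinearMap.rTensor_comp, ← LinearMap.rTensor_comp, LinearMap.comp_assoc]
      congr 1
      exact HopfAlgebra.mul_antipode_lTensor_comul
    have e' := LinearMap.congr_fun e (Δ c)
    simp only [LinearMap.comp_apply] at e'
    rw [e']
    simp [Q, Δ]
  rw [← hEc]
  refine (tensorSub_le fun u _ v hv => ?_ : _ ≤ LinearMap.ker (t ∘ₗ E)) (hK c hc)
  rw [LinearMap.mem_ker, LinearMap.comp_apply, hE]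
  exact h0 v hv _

/-- A functional on the top layer produces a colinear map `g` from `H` to `K`, and `t` composed with
any such map has the integral property. The twists of `g` by elements of `K` ensure that one of
these composites is nonzero. -/
theorem IsHopfFiltration.isCoFrobenius {K : Submodule k H} {F : ℕ → Submodule k H}
    (hF : IsHopfFiltration K F) (hK : IsHopfSubalgebra k K) {t : H →ₗ[k] k} (ht : IsHaar K t)
    (hfin : ∃ n, F n = ⊤) : IsCoFrobenius k H := by
  classical
  have hnt : (1 : H) ≠ 0 := by
    intro h
    have := Bialgebra.counit_one (R := k) (A := H)
    rw [h, map_zero] at this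
    exact zero_ne_one this
  -- `m + 1` is the least index at which `F` is everything; it is positive because `F 0 = 0` and `1
  -- ≠ 0`.
  obtain ⟨m, hm, hm'⟩ : ∃ m, F m ≠ ⊤ ∧ F (m + 1) = ⊤ := by
    have hpos : Nat.find hfin ≠ 0 := fun h => by
      have h1 := Nat.find_spec hfin
      rw [h, hF.zero] at h1
      exact hnt ((Submodule.mem_bot k).1 (h1 ▸ Submodule.mem_top : (1 : H) ∈ (⊥ : Submodule k H)))
    obtain ⟨m, hm⟩ := Nat.exists_eq_succ_of_ne_zero hpos
    refine ⟨m, Nat.find_min hfin (by omega), ?_⟩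
    have h1 := Nat.find_spec hfin
    rwa [hm] at h1
  obtain ⟨f, hf0, hf⟩ := Submodule.exists_le_ker_of_lt_top _ (lt_top_iff_ne_top.2 hm)
  have hgK : ∀ h, hitRight f h ∈ K := by
    intro h
    refine (sup_le (tensorSub_le fun a ha b _ => ?_) (tensorSub_le fun a _ b hb => ?_) :
      _ ≤ K.comap (contractRight f)) (hF.comul_left m h (hm' ▸ Submodule.mem_top))
    · rw [Submodule.mem_comap, contractRight_tmul]
      exact K.smul_mem _ ha
    · have : f b = 0 := hf hb
      rw [Submodule.mem_comap, contractRight_tmul, this, zero_smul]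
      exact K.zero_mem
  have hmem : ∀ c ∈ K, ∀ h, twist (hitRight f) c h ∈ K := by
    intro c hc h
    rw [twist_apply]
    refine (tensorSub_le fun a _ b hb => ?_ : _ ≤ K.comap (LinearMap.mul' k H ∘ₗ
      TensorProduct.map _ _)) (hK.isSubcoalgebra c hc)
    exact hK.mul_mem _ (hgK _) b hb
  rw [isCoFrobenius_iff]
  by_contra! hcon
  refine hf0 (LinearMap.ext fun h => ?_)
  have hT : ∀ c ∈ K, ∀ h, t (twist (hitRight f) c h) = 0 := by
    intro c hc
    by_contra! hne
    obtain ⟨x, hx⟩ := hne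
    obtain ⟨h, hh⟩ := hcon (t ∘ₗ twist (hitRight f) c) fun h0 => hx (LinearMap.congr_fun h0 x)
    refine hh ?_
    -- With `G` the twist, colinearity gives `h₁ t(G(h₂)) = G(h)₁ t(G(h)₂)`, which is `t(G(h)) 1`
    -- because `G(h)` is in `K`.
    have h1 := ht.left _ (hmem c hc h)
    rw [hitRight_apply, comul_twist (comul_hitRight f), LinearMap.lTensor, contractRight_map] at h1
    exact h1
  have h0 : hitRight f h = 0 := ht.eq_zero_of_mul_right hK (hgK h) fun c hc =>
    apply_mul_eq_zero_of_twist hK.isSubcoalgebra hT h hc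
  rw [← counit_hitRight, h0, map_zero, LinearMap.zero_apply]

end FilteredHopf

/-! ### The coradical filtration of `H` -/

section CoradicalFiltration

variable {k : Type*} [Field k] {H : Type*} [Ring H] [HopfAlgebra k H] [hH : HasHopfCoradical k H]

theorem isHopfFiltration_coradFilPred :
    IsHopfFiltration (coradical k H) (coradFilPred k H) where
  zero := rfl
  mono := coradFilPred_mono
  exhaustive := exists_mem_coradFilPred
  -- The shifted layers satisfy `F n · H₀ ⊆ F (n + 0)`.
  mul_mem n _ hx _ hy := mul_mem_coradFilPred_left (n := 0) hx hy
  antipode_mem _ _ hx := antipode_mem_coradFilPred hx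
  isSubcoalgebra := isSubcoalgebra_coradFilPred
  comul_right n x hx := by
    refine comul_mem_of_forall (fun i j hij u hu v hv => ?_) (n := n) hx
    rcases Nat.eq_zero_or_pos j with rfl | hj
    · exact Submodule.mem_sup_right (tmul_mem_tensorSub trivial hv)
    · exact Submodule.mem_sup_left (tmul_mem_tensorSub
        (mem_coradFilPred_of_lt (by omega) hu) trivial)
  comul_left n x hx := by
    refine comul_mem_of_forall (fun i j hij u hu v hv => ?_) (n := n) hx
    rcases Nat.eq_zero_or_pos i with rfl | hi
    · exact Submodule.mem_sup_left (tmul_mem_tensorSub hu trivial)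
    · exact Submodule.mem_sup_right (tmul_mem_tensorSub trivial
        (mem_coradFilPred_of_lt (by omega) hv))

theorem isCoFrobenius_iff_exists_coradFil_eq_top :
    IsCoFrobenius k H ↔ ∃ n, coradFil k H n = ⊤ := by
  obtain ⟨t, ht⟩ := exists_isHaar_coradical (k := k) (H := H)
  constructor
  · intro h
    obtain ⟨n, hn⟩ := isHopfFiltration_coradFilPred.exists_eq_top hH.isHopfSubalgebra ht h
    exact ⟨n, top_le_iff.1 (hn ▸ coradFilPred_le n)⟩
  · rintro ⟨n, hn⟩
    exact isHopfFiltration_coradFilPred.isCoFrobenius hH.isHopfSubalgebra ht ⟨n + 1, hn⟩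

end CoradicalFiltration

/-! ### The degree filtration of the associated graded coalgebra -/

section GradedFiltration

variable {k : Type*} [Field k] {C : Type*} [AddCommGroup C] [Module k C] [Coalgebra k C]

variable (k C) in
/-- The sum of the homogeneous components of `gr C` of degree less than `n`. -/
def grFil (n : ℕ) : Submodule k (Gr k C) :=
  Submodule.span k {a | ∃ i < n, ∃ x : coradFil k C i, grMk k i x = a}

theorem grMk_mem_grFil {i n : ℕ} (h : i < n) (x : coradFil k C i) : grMk k i x ∈ grFil k C n :=
  Submodule.subset_span ⟨i, h, x, rfl⟩

theorem grFil_le {n : ℕ} {P : Submodule k (Gr k C)} (h : ∀ i < n, ∀ x, grMk k i x ∈ P) :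
    grFil k C n ≤ P := by
  refine Submodule.span_le.2 ?_
  rintro _ ⟨i, hi, x, rfl⟩
  exact h i hi x

theorem grFil_mono : Monotone (grFil k C) := fun _ _ hmn =>
  grFil_le fun _ hi x => grMk_mem_grFil (hi.trans_le hmn) x

theorem grMk_mem_grFil_one_iff {a : Gr k C} :
    a ∈ grFil k C 1 ↔ ∃ x : coradFil k C 0, grMk k 0 x = a := by
  refine ⟨fun h => (grFil_le ?_ : _ ≤ LinearMap.range (grMk k 0)) h, ?_⟩
  · intro i hi x
    obtain rfl : i = 0 := by omega
    exact ⟨x, rfl⟩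
  · rintro ⟨x, rfl⟩
    exact grMk_mem_grFil Nat.zero_lt_one x

theorem eq_top_of_forall_grMk_mem {P : Submodule k (Gr k C)} (h : ∀ n x, grMk k n x ∈ P) :
    P = ⊤ := by
  rw [← P.ker_mkQ, LinearMap.ker_eq_top]
  exact gr_hom_ext fun n x => (Submodule.Quotient.mk_eq_zero P).2 (h n x)

theorem exists_mem_grFil (a : Gr k C) : ∃ n, a ∈ grFil k C n := by
  rw [← Submodule.mem_iSup_of_directed _ grFil_mono.directed_le,
    eq_top_of_forall_grMk_mem fun n x =>
      Submodule.mem_iSup_of_mem (n + 1) (grMk_mem_grFil (Nat.lt_succ_self n) x)]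
  trivial

theorem comul_grMk_mem {P : Submodule k (Gr k C ⊗[k] Gr k C)} {n : ℕ}
    (h : ∀ i j, i + j = n → ∀ (u : coradFil k C i) (v : coradFil k C j),
      grMk k i u ⊗ₜ[k] grMk k j v ∈ P) (x : coradFil k C n) :
    Coalgebra.comul (R := k) (grMk k n x) ∈ P := by
  rw [comul_grMk]
  refine comul_mem_of_forall (P := P.comap (grTensor k C n)) (fun i j hij u hu v hv => ?_) x.2
  rw [Submodule.mem_comap, grTensor_tmul hij hu hv]
  exact h i j hij _ _

theorem isSubcoalgebra_grFil (n : ℕ) : IsSubcoalgebra k (grFil k C n) := by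
  intro a ha
  refine (grFil_le fun i hi x => ?_ : _ ≤ (tensorSub k _ _).comap Coalgebra.comul) ha
  exact comul_grMk_mem (fun a b hab u v => tmul_mem_tensorSub (grMk_mem_grFil (by omega) u)
    (grMk_mem_grFil (by omega) v)) x

variable (k C) in
/-- The projection of `gr C` onto its component of degree `n`. -/
def grComponent (n : ℕ) : Gr k C →ₗ[k] grPiece k C n := DirectSum.component k ℕ (grPiece k C) n

theorem grComponent_grMk (n : ℕ) (x : coradFil k C n) : grComponent k C n (grMk k n x) =
    ((coradFilPred k C n).submoduleOf (coradFil k C n)).mkQ x :=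
  DirectSum.component.lof_self _ _ _

theorem grComponent_grMk_of_ne {i n : ℕ} (h : i ≠ n) (x : coradFil k C i) :
    grComponent k C n (grMk k i x) = 0 :=
  (DirectSum.component.of _ _ _ _).trans (dif_neg h)

theorem mem_coradFilPred_of_grMk_mem {m n : ℕ} (hmn : n ≤ m) {x : coradFil k C m}
    (h : grMk k m x ∈ grFil k C n) : (x : C) ∈ coradFilPred k C m := by
  have hle : grFil k C n ≤ LinearMap.ker (grComponent k C m) :=
    grFil_le fun i hi y => grComponent_grMk_of_ne (by omega) y
  have h1 : grComponent k C m (grMk k m x) = 0 := hle h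
  rw [grComponent_grMk] at h1
  exact (Submodule.Quotient.mk_eq_zero ((coradFilPred k C m).submoduleOf (coradFil k C m))).1 h1

/-- If `gr C` has no degrees `≥ n`, the quotients `C_m / C_{m-1}` vanish for `m ≥ n`. The filtration
is then constant from there on, and exhaustiveness makes that layer all of `C`. -/
theorem exists_grFil_eq_top_iff :
    (∃ n, grFil k C n = ⊤) ↔ ∃ n, coradFil k C n = ⊤ := by
  constructor
  · rintro ⟨n, hn⟩
    have hstep : ∀ m, n ≤ m → coradFilPred k C (m + 1) ≤ coradFilPred k C m := fun m hm x hx =>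
      mem_coradFilPred_of_grMk_mem hm (x := ⟨x, hx⟩) (hn ▸ Submodule.mem_top)
    have hle : ∀ m, coradFilPred k C (n + m) ≤ coradFilPred k C n := by
      intro m
      induction m with
      | zero => exact le_rfl
      | succ m ih => exact (hstep (n + m) (by omega)).trans ih
    refine ⟨n, eq_top_iff.2 fun x _ => coradFilPred_le n ?_⟩
    obtain ⟨m, hm⟩ := exists_mem_coradFilPred (k := k) x
    exact hle m (coradFilPred_mono (by omega : m ≤ n + m) hm)
  · rintro ⟨n, hn⟩
    refine ⟨n + 1, eq_top_of_forall_grMk_mem fun m x => ?_⟩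
    rcases lt_or_ge m (n + 1) with h | h
    · exact grMk_mem_grFil h x
    · rw [grMk_eq_zero (mem_coradFilPred_of_lt (by omega : n < m) (hn ▸ Submodule.mem_top))]
      exact Submodule.zero_mem _

end GradedFiltration

/-! ### Integrals on `gr H` -/

section GradedHopf

variable {k : Type*} [Field k] {H : Type*} [Ring H] [HopfAlgebra k H] [hH : HasHopfCoradical k H]

theorem antipode_grMk (n : ℕ) (x : coradFil k H n) : HopfAlgebra.antipode k (grMk k n x) =
    grMk k n ⟨HopfAlgebra.antipode k (x : H), antipode_mem_coradFil x.2⟩ :=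
  grAntipode_grMk n x

theorem antipode_mem_grFil (n : ℕ) (a : Gr k H) (ha : a ∈ grFil k H n) :
    HopfAlgebra.antipode k a ∈ grFil k H n := by
  refine (grFil_le fun i hi x => ?_ : _ ≤ (grFil k H n).comap (HopfAlgebra.antipode k)) ha
  rw [Submodule.mem_comap, antipode_grMk]
  exact grMk_mem_grFil hi _

theorem mul_mem_grFil (n : ℕ) (a : Gr k H) (ha : a ∈ grFil k H n) (b : Gr k H)
    (hb : b ∈ grFil k H 1) : a * b ∈ grFil k H n := by
  obtain ⟨y, rfl⟩ := grMk_mem_grFil_one_iff.1 hb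
  refine (grFil_le fun i hi x => ?_ :
    _ ≤ (grFil k H n).comap (LinearMap.mulRight k (grMk k 0 y))) ha
  rw [Submodule.mem_comap, LinearMap.mulRight_apply, grMk_mul_grMk]
  exact grMk_mem_grFil hi _

theorem isHopfSubalgebra_grFil_one : IsHopfSubalgebra k (grFil k H 1) where
  one_mem := grMk_mem_grFil Nat.zero_lt_one _
  mul_mem := mul_mem_grFil 1
  isSubcoalgebra := isSubcoalgebra_grFil 1
  antipode_mem := antipode_mem_grFil 1

theorem isHopfFiltration_grFil : IsHopfFiltration (grFil k H 1) (grFil k H) where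
  zero := le_bot_iff.1 (grFil_le fun _ hi => absurd hi (Nat.not_lt_zero _))
  mono := grFil_mono
  exhaustive := exists_mem_grFil
  mul_mem := mul_mem_grFil
  antipode_mem := antipode_mem_grFil
  isSubcoalgebra := isSubcoalgebra_grFil
  comul_right n a ha := by
    refine (grFil_le fun m hm x => ?_ : _ ≤ (_ ⊔ _ : Submodule k _).comap Coalgebra.comul) ha
    rw [Submodule.mem_comap]
    refine comul_grMk_mem (fun i j hij u v => ?_) x
    rcases Nat.eq_zero_or_pos j with rfl | hj
    · exact Submodule.mem_sup_right (tmul_mem_tensorSub trivial (grMk_mem_grFil Nat.zero_lt_one v))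
    · exact Submodule.mem_sup_left (tmul_mem_tensorSub (grMk_mem_grFil (by omega) u) trivial)
  comul_left n a ha := by
    refine (grFil_le fun m hm x => ?_ : _ ≤ (_ ⊔ _ : Submodule k _).comap Coalgebra.comul) ha
    rw [Submodule.mem_comap]
    refine comul_grMk_mem (fun i j hij u v => ?_) x
    rcases Nat.eq_zero_or_pos i with rfl | hi
    · exact Submodule.mem_sup_left (tmul_mem_tensorSub (grMk_mem_grFil Nat.zero_lt_one u) trivial)
    · exact Submodule.mem_sup_right (tmul_mem_tensorSub trivial (grMk_mem_grFil (by omega) v))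

/-- The integral of the coradical, extended by zero to `gr H`. -/
theorem exists_isHaar_grFil : ∃ t : Gr k H →ₗ[k] k, IsHaar (grFil k H 1) t := by
  obtain ⟨t, ht⟩ := exists_isHaar_coradical (k := k) (H := H)
  let t' : Gr k H →ₗ[k] k := t ∘ₗ (coradicalSubalgebra k H).val.toLinearMap ∘ₗ grProjLin k H
  have ht' : ∀ x : coradFil k H 0, t' (grMk k 0 x) = t x := fun x => by
    simp only [t', LinearMap.comp_apply]
    rw [grProjLin_grMk_zero]
    rfl
  -- Writing `1` as the image of `1` under `grExt k 0` lets both integral identities be transported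
  -- from `H₀`, where they are known.
  have h1 : (1 : Gr k H) = grExt k 0 1 := (grExt_eq (one_mem_coradFil (k := k))).symm
  refine ⟨t', (ht' _).trans ht.map_one, fun a ha => ?_, fun a ha => ?_⟩ <;>
    obtain ⟨x, rfl⟩ := grMk_mem_grFil_one_iff.1 ha
  · rw [hitRight_apply, comul_grMk, ht', h1, ← map_smul, ← ht.left x x.2, hitRight_apply]
    refine comul_mem_of_forall (P := LinearMap.eqLocus (contractRight t' ∘ₗ grTensor k H 0)
      (grExt k 0 ∘ₗ contractRight t)) (fun i j hij u hu v hv => ?_) x.2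
    obtain rfl : i = 0 := by omega
    obtain rfl : j = 0 := by omega
    rw [LinearMap.mem_eqLocus, LinearMap.comp_apply, LinearMap.comp_apply, grTensor_tmul rfl hu hv,
      contractRight_tmul, contractRight_tmul, map_smul, ht', grExt_eq hu]
  · rw [hitLeft_apply, comul_grMk, ht', h1, ← map_smul, ← ht.right x x.2, hitLeft_apply]
    refine comul_mem_of_forall (P := LinearMap.eqLocus (contractLeft t' ∘ₗ grTensor k H 0)
      (grExt k 0 ∘ₗ contractLeft t)) (fun i j hij u hu v hv => ?_) x.2
    obtain rfl : i = 0 := by omega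
    obtain rfl : j = 0 := by omega
    rw [LinearMap.mem_eqLocus, LinearMap.comp_apply, LinearMap.comp_apply, grTensor_tmul rfl hu hv,
      contractLeft_tmul, contractLeft_tmul, map_smul, ht', grExt_eq hv]

theorem isCoFrobenius_gr_iff : IsCoFrobenius k (Gr k H) ↔ ∃ n, grFil k H n = ⊤ := by
  obtain ⟨t, ht⟩ := exists_isHaar_grFil (k := k) (H := H)
  exact ⟨isHopfFiltration_grFil.exists_eq_top isHopfSubalgebra_grFil_one ht,
    isHopfFiltration_grFil.isCoFrobenius isHopfSubalgebra_grFil_one ht⟩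

/-! ### The diagram and the decomposition `gr H = R H₀` -/

variable (k H) in
/-- The inclusion `H₀ → gr H` of the component of degree zero. -/
def grIncl : coradicalSubalgebra k H →ₗ[k] Gr k H :=
  grMk k 0 ∘ₗ (LinearMap.id : coradicalSubalgebra k H →ₗ[k] coradicalSubalgebra k H)

theorem grIncl_grProjLin_grMk_zero (x : coradFil k H 0) :
    grIncl k H (grProjLin k H (grMk k 0 x)) = grMk k 0 x := by
  rw [grProjLin_grMk_zero]
  rfl

theorem grProjLin_grIncl (x : coradicalSubalgebra k H) : grProjLin k H (grIncl k H x) = x :=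
  grProjLin_grMk_zero (k := k) (H := H) x

variable (k H) in
/-- The projection of `gr H` onto its component of degree zero, as a morphism of coalgebras. -/
def grProjCoalg : Gr k H →ₗc[k] Gr k H where
  __ := grIncl k H ∘ₗ grProjLin k H
  counit_comp := by
    refine gr_hom_ext fun n x => ?_
    change Coalgebra.counit (R := k) (grIncl k H (grProjLin k H (grMk k n x))) = _
    rcases Nat.eq_zero_or_pos n with rfl | hn
    · rw [grIncl_grProjLin_grMk_zero]
    · rw [grProjLin_grMk_of_pos hn, map_zero, map_zero]
      exact (grCounit_grMk_of_pos hn x).symm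
  map_comp_comul := by
    refine gr_hom_ext fun n x => ?_
    change TensorProduct.map (grIncl k H ∘ₗ grProjLin k H) (grIncl k H ∘ₗ grProjLin k H)
      (Coalgebra.comul (R := k) (grMk k n x)) =
        Coalgebra.comul (R := k) (grIncl k H (grProjLin k H (grMk k n x)))
    rcases Nat.eq_zero_or_pos n with rfl | hn
    · rw [grIncl_grProjLin_grMk_zero]
      refine comul_grMk_mem (P := LinearMap.eqLocus (TensorProduct.map (grIncl k H ∘ₗ grProjLin k H)
        (grIncl k H ∘ₗ grProjLin k H)) LinearMap.id) (fun i j hij u v => ?_) x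
      obtain rfl : i = 0 := by omega
      obtain rfl : j = 0 := by omega
      rw [LinearMap.mem_eqLocus, TensorProduct.map_tmul, LinearMap.comp_apply, LinearMap.comp_apply,
        grIncl_grProjLin_grMk_zero, grIncl_grProjLin_grMk_zero]
      rfl
    · rw [grProjLin_grMk_of_pos hn, map_zero, map_zero]
      refine comul_grMk_mem (P := LinearMap.ker _) (fun i j hij u v => ?_) x
      rw [LinearMap.mem_ker, TensorProduct.map_tmul, LinearMap.comp_apply, LinearMap.comp_apply]
      rcases Nat.eq_zero_or_pos i with rfl | hi
      · rw [grProjLin_grMk_of_pos (by omega : 0 < j), map_zero, TensorProduct.tmul_zero]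
      · rw [grProjLin_grMk_of_pos hi, map_zero, TensorProduct.zero_tmul]

theorem mem_diagram_iff {a : Gr k H} : a ∈ diagram k H ↔
    (grProjLin k H).lTensor (Gr k H) (Coalgebra.comul (R := k) a) = a ⊗ₜ 1 := Iff.rfl

/-- Coinvariance says that `a ⊗ 1` is the part of `Δ a` with right factor in degree zero. The
remaining terms have right factor of positive degree, so their left factors have degree less than
`n`. -/
theorem comul_sub_mem_of_mem_diagram {a : Gr k H} (ha : a ∈ diagram k H) {n : ℕ}
    (han : a ∈ grFil k H (n + 1)) :
    Coalgebra.comul (R := k) a - a ⊗ₜ 1 ∈ tensorSub k (grFil k H n) ⊤ := by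
  have h1 : (grIncl k H ∘ₗ grProjLin k H).lTensor (Gr k H) (Coalgebra.comul (R := k) a) =
      a ⊗ₜ 1 := by
    rw [LinearMap.lTensor_comp, LinearMap.comp_apply, mem_diagram_iff.1 ha, LinearMap.lTensor_tmul]
    rfl
  rw [← h1]
  refine (sup_le (tensorSub_le fun u hu v _ => ?_) (tensorSub_le fun u _ v hv => ?_) :
    _ ≤ (tensorSub k (grFil k H n) ⊤).comap
      (LinearMap.id - (grIncl k H ∘ₗ grProjLin k H).lTensor (Gr k H)))
    (isHopfFiltration_grFil.comul_right n a han)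
  · rw [Submodule.mem_comap, LinearMap.sub_apply, LinearMap.lTensor_tmul, LinearMap.id_apply]
    exact Submodule.sub_mem _ (tmul_mem_tensorSub hu trivial) (tmul_mem_tensorSub hu trivial)
  · obtain ⟨x, rfl⟩ := grMk_mem_grFil_one_iff.1 hv
    rw [Submodule.mem_comap, LinearMap.sub_apply, LinearMap.lTensor_tmul, LinearMap.comp_apply,
      grIncl_grProjLin_grMk_zero, LinearMap.id_apply, sub_self]
    exact Submodule.zero_mem _

/-- The map `Φ(y) = y₁ T(h y₂) = S(h₁) T(h₂ y)` takes values in a finite-dimensional space fixed by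
`Δ h`. On coinvariants it is `T(h) y` up to lower degree, with `T(h) ≠ 0`, hence injective. -/
theorem finiteDimensional_diagram (hco : IsCoFrobenius k (Gr k H)) :
    FiniteDimensional k (diagram k H) := by
  obtain ⟨T, hT0, hT⟩ := isCoFrobenius_iff.1 hco
  obtain ⟨h, hh⟩ : ∃ h, T h ≠ 0 := by
    by_contra! hcon
    exact hT0 (LinearMap.ext hcon)
  obtain ⟨V, hV, hhV⟩ := exists_fg_mem_tensorSub (Coalgebra.comul (R := k) h)
  let W : Submodule k (Gr k H) := V.map (HopfAlgebra.antipode k)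
  have : FiniteDimensional k W := Module.Finite.iff_fg.2 (hV.map _)
  let Φ : Gr k H →ₗ[k] Gr k H := hitRight (T ∘ₗ LinearMap.mulLeft k h)
  have hΦ : ∀ y, Φ y ∈ W := by
    intro y
    have h1 := hitRight_mulLeft (K := (⊤ : Submodule k (Gr k H))) (T := T) (x := h) (y := y)
      (fun d _ => by rw [tensorSub_top_top]; trivial) (fun x _ => hT _) trivial
    change hitRight _ y ∈ W
    rw [h1]
    exact Submodule.mem_map_of_mem (contractRight_mem hhV _)
  have hinj : ∀ n, ∀ y ∈ diagram k H, y ∈ grFil k H n → Φ y = 0 → y = 0 := by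
    intro n
    induction n with
    | zero =>
      intro y _ hy _
      rwa [isHopfFiltration_grFil.zero, Submodule.mem_bot] at hy
    | succ n ih =>
      intro y hyR hy hy0
      -- If `Φ(y) = 0`, then `T(h) y` lies in the next smaller layer, so `y` descends step by step
      -- to `grFil k H 0 = 0`.
      refine ih y hyR ?_ hy0
      have h1 := contractRight_mem (comul_sub_mem_of_mem_diagram hyR hy)
        (T ∘ₗ LinearMap.mulLeft k h)
      rw [map_sub, ← hitRight_apply, contractRight_tmul] at h1
      change Φ y - _ ∈ _ at h1
      rw [hy0, zero_sub, LinearMap.comp_apply, LinearMap.mulLeft_apply, mul_one] at h1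
      exact (Submodule.smul_mem_iff _ hh).1 ((Submodule.neg_mem_iff _).1 h1)
  let Ψ : diagram k H →ₗ[k] W := (Φ ∘ₗ (diagram k H).val.toLinearMap).codRestrict W fun y => hΦ _
  refine FiniteDimensional.of_injective Ψ ((injective_iff_map_eq_zero Ψ).2 fun y hy => ?_)
  obtain ⟨n, hn⟩ := exists_mem_grFil (y : Gr k H)
  exact Subtype.ext (hinj n y y.2 hn (congrArg Subtype.val hy))

/-- Every element of `gr H` is a sum of products of coinvariants and elements of degree zero. -/
theorem mem_of_forall_diagram_mul_mem {P : Submodule k (Gr k H)}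
    (hP : ∀ a ∈ diagram k H, ∀ b ∈ grFil k H 1, a * b ∈ P) (a : Gr k H) : a ∈ P := by
  let p := grProjCoalg k H
  let S := HopfAlgebra.antipode k (A := Gr k H)
  -- Radford's projection onto the coinvariants, `E(a) = a₁ S(p(a₂))`. Since `S p` is the
  -- convolution inverse of `p`, one recovers `a = E(a₁) p(a₂)`.
  let E : Gr k H →ₗ[k] Gr k H :=
    (WithConv.toConv LinearMap.id * WithConv.toConv (S ∘ₗ p.toLinearMap)).ofConv
  let ρ : Gr k H →ₐ[k] Gr k H ⊗[k] coradicalSubalgebra k H :=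
    (Algebra.TensorProduct.map (AlgHom.id k (Gr k H)) (grProj k H)).comp
      (Bialgebra.comulAlgHom k (Gr k H))
  let i : Gr k H →ₐ[k] Gr k H ⊗[k] coradicalSubalgebra k H := Algebra.TensorProduct.includeLeft
  let j : Gr k H →ₗ[k] Gr k H ⊗[k] coradicalSubalgebra k H :=
    TensorProduct.mk k _ _ 1 ∘ₗ grProjLin k H
  have hone : (1 : WithConv (Gr k H →ₗ[k] Gr k H)).ofConv ∘ₗ p.toLinearMap =
      (1 : WithConv (Gr k H →ₗ[k] Gr k H)).ofConv := by
    ext x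
    simp
  have hpS : WithConv.toConv p.toLinearMap * WithConv.toConv (S ∘ₗ p.toLinearMap) = 1 := by
    have h := LinearMap.convMul_comp_coalgHom_distrib
      (WithConv.toConv LinearMap.id) (WithConv.toConv S) p
    rw [LinearMap.id_mul_antipode, hone] at h
    exact congrArg WithConv.toConv h.symm
  have hSp : WithConv.toConv (S ∘ₗ p.toLinearMap) * WithConv.toConv p.toLinearMap = 1 := by
    have h := LinearMap.convMul_comp_coalgHom_distrib
      (WithConv.toConv S) (WithConv.toConv LinearMap.id) p
    rw [LinearMap.antipode_mul_id, hone] at h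
    exact congrArg WithConv.toConv h.symm
  have hEp : WithConv.toConv E * WithConv.toConv p.toLinearMap = WithConv.toConv LinearMap.id := by
    change WithConv.toConv LinearMap.id * WithConv.toConv (S ∘ₗ p.toLinearMap) *
      WithConv.toConv p.toLinearMap = _
    rw [mul_assoc, hSp, mul_one]
  have hij : ∀ x, LinearMap.mul' k _ (TensorProduct.map i.toLinearMap j x) =
      (grProjLin k H).lTensor (Gr k H) x := by
    intro x
    have e : LinearMap.mul' k _ ∘ₗ TensorProduct.map i.toLinearMap j =
        (grProjLin k H).lTensor (Gr k H) := by
      ext x y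
      simp [i, j]
    exact LinearMap.congr_fun e x
  have hρij : WithConv.toConv i.toLinearMap * WithConv.toConv j =
      WithConv.toConv ρ.toLinearMap := by
    ext x
    exact hij _
  have hjp : j ∘ₗ p.toLinearMap = j := by
    refine LinearMap.ext fun x => congrArg (fun y => (1 : Gr k H) ⊗ₜ[k] y) ?_
    exact grProjLin_grIncl _
  have hρp : WithConv.toConv (i.toLinearMap ∘ₗ p.toLinearMap) * WithConv.toConv j =
      WithConv.toConv (ρ.toLinearMap ∘ₗ p.toLinearMap) := by
    have h := LinearMap.convMul_comp_coalgHom_distrib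
      (WithConv.toConv i.toLinearMap) (WithConv.toConv j) p
    rw [hρij] at h
    simp only at h
    rw [hjp] at h
    exact congrArg WithConv.toConv h.symm
  -- The values of `E` are coinvariant. From `ρ = i * j`, `i = (i E) * (i p)` and `(i p) * j = ρ p`,
  -- it follows that `ρ E = ρ * (ρ S p) = (i E) * (ρ p) * (ρ S p) = i E`.
  have hρ : WithConv.toConv (ρ.toLinearMap ∘ₗ E) = WithConv.toConv (i.toLinearMap ∘ₗ E) := by
    have h1 := congrArg WithConv.toConv (LinearMap.algHom_comp_convMul_distrib ρ
      (WithConv.toConv LinearMap.id) (WithConv.toConv (S ∘ₗ p.toLinearMap)))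
    have h2 := congrArg WithConv.toConv (LinearMap.algHom_comp_convMul_distrib i
      (WithConv.toConv E) (WithConv.toConv p.toLinearMap))
    have h3 := congrArg WithConv.toConv (LinearMap.algHom_comp_convMul_distrib ρ
      (WithConv.toConv p.toLinearMap) (WithConv.toConv (S ∘ₗ p.toLinearMap)))
    rw [hEp] at h2
    rw [hpS] at h3
    simp only [WithConv.toConv_ofConv, LinearMap.comp_id] at h1 h2 h3
    have h4 : WithConv.toConv (ρ.toLinearMap ∘ₗ
        (1 : WithConv (Gr k H →ₗ[k] Gr k H)).ofConv) = 1 := by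
      ext x
      simp
    rw [h4] at h3
    refine h1.trans ?_
    rw [← hρij, h2, mul_assoc (WithConv.toConv (i.toLinearMap ∘ₗ E)), hρp, mul_assoc, ← h3, mul_one]
  have hE : ∀ x, E x ∈ diagram k H := fun x =>
    LinearMap.congr_fun (WithConv.toConv_injective hρ) x
  have hp : ∀ x, p x ∈ grFil k H 1 := fun x => grMk_mem_grFil Nat.zero_lt_one _
  have ha : LinearMap.mul' k (Gr k H) (TensorProduct.map E p.toLinearMap
      (Coalgebra.comul (R := k) a)) = a :=
    LinearMap.congr_fun (WithConv.toConv_injective hEp) a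
  rw [← ha]
  generalize Coalgebra.comul (R := k) a = s
  induction s with
  | zero => simp
  | tmul x y => exact hP _ (hE x) _ (hp y)
  | add s t hs ht => rw [map_add, map_add]; exact P.add_mem hs ht

/-- A finite spanning set of the diagram has bounded degree, and right multiplication by degree zero
elements does not raise degrees; so the bound passes to `gr H = R H₀`. -/
theorem exists_grFil_eq_top_of_finiteDimensional_diagram [FiniteDimensional k (diagram k H)] :
    ∃ n, grFil k H n = ⊤ := by
  obtain ⟨n, hn⟩ : ∃ n, Subalgebra.toSubmodule (diagram k H) ≤ grFil k H n := by
    have hfg : (Subalgebra.toSubmodule (diagram k H)).FG := Module.Finite.iff_fg.1 ‹_›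
    obtain ⟨s, hs⟩ := hfg
    choose f hf using exists_mem_grFil (k := k) (C := H)
    refine ⟨s.sup f, ?_⟩
    rw [← hs, Submodule.span_le]
    exact fun x hx => grFil_mono (Finset.le_sup hx) (hf x)
  exact ⟨n, eq_top_iff.2 fun a _ => mem_of_forall_diagram_mul_mem
    (fun x hx y hy => mul_mem_grFil n x (hn hx) y hy) a⟩

end GradedHopf

end

end CoradFilt

theorem theoremB {k : Type*} [Field k] {H : Type*} [Ring H] [HopfAlgebra k H]
    [CoradFilt.HasHopfCoradical k H] :
    List.TFAE [
      CoradFilt.IsCoFrobenius k H,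
      CoradFilt.IsCoFrobenius k (CoradFilt.Gr k H),
      FiniteDimensional k (CoradFilt.diagram k H),
      ∃ n : ℕ, CoradFilt.coradFil k H n = ⊤] := by
  tfae_have 1 ↔ 4 := CoradFilt.isCoFrobenius_iff_exists_coradFil_eq_top
  tfae_have 2 ↔ 4 := CoradFilt.isCoFrobenius_gr_iff.trans CoradFilt.exists_grFil_eq_top_iff
  tfae_have 2 → 3 := CoradFilt.finiteDimensional_diagram
  tfae_have 3 → 4 := fun _ => CoradFilt.exists_grFil_eq_top_iff.1
    CoradFilt.exists_grFil_eq_top_of_finiteDimensional_diagram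
  tfae_finish
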